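/- Let $H$ and $H_k$ ($k\ge 1$) be real Hilbert spaces, and let $(a,D(a))$ and $(a^{(k)},D(a^{(k)}))$ be densely defined, closed, symmetric, nonnegative bilinear forms on $H$ and $H_k$ respectively (closed: $D(a)$ is complete for the norm $(a(u,u)+\|u\|^2)^{1/2}$). Put $a(u,u)=\infty$ for $u\in H\setminus D(a)$, and likewise for $a^{(k)}$. Let $E_k:H_k\to H$ be bounded linear operators whose adjoints $\pi_k:=E_k^*:H\to H_k$ satisfy $\pi_kE_kv=v$ for all $v\in H_k$, $\sup_k\|\pi_k\|<\infty$, and $\lim_{k\to\infty}\|\pi_kf\|=\|f\|$ for every $f\in H$. Let $A$ be the infinitesimal generator of $a$: $u\in D(A)$ and $Au=g$ if and only if $u\in D(a)$ and $a(u,v)=-\langle g,v\rangle$ for all $v\in D(a)$. Let $(T_t)_{t\ge 0}$ be the strongly continuous semigroup of symmetric contractions on $H$ with generator $A$, and for $\lambda>0$ let $G_\lambda$ be the resolvent: for $f\in H$, $G_\lambda f$ is the unique element of $D(a)$ with $a(G_\lambda f,v)+\lambda\langle G_\lambda f,v\rangle=\langle f,v\rangle$ for all $v\in D(a)$. Let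 $A^{(k)}$, $(T^{(k)}_t)_{t\ge0}$ and $G^{(k)}_\lambda$ be the corresponding objects for $a^{(k)}$. Let $C_0$ be any core of $A$, i.e. a linear subspace of $D(A)$ such that $A$ is the closure of $A|_{C_0}$. Then the following are equivalent. (i) $a^{(k)}$ is Mosco-convergent to $a$ in the generalized sense: (a) if $v_k\in H_k$, $u\in H$ and $E_kv_k\to u$ weakly in $H$, then $\liminf_{k\to\infty}a^{(k)}(v_k,v_k)\ge a(u,u)$; (b) for every $u\in H$ there are $u_k\in H_k$ such that $E_ku_k\to u$ strongly in $H$ and $\limsup_{k\to\infty}a^{(k)}(u_k,u_k)\le a(u,u)$. (ii) For every $f\in H$, $E_kT^{(k)}_t\pi_kf\to T_tf$ in $H$, uniformly for $t$ in any bounded interval $[0,s]$. (iii) For every $f\in C_0$ there are $f_k\in D(A^{(k)})$ such that $E_kf_k\to f$ and $E_kA^{(k)}f_k\to Af$ in $H$. (iv) For every $\lambda>0$ and every $f\in H$, $E_kG^{(k)}_\lambda\pi_kf\to G_\lambda f$ in $H$. -/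

import Mathlib

open Filter Topology
open scoped NNReal ENNReal RealInnerProductSpace

/-- A densely defined, closed, symmetric, nonnegative bilinear form on a real Hilbert space.
Closedness: the domain is complete for the inner product `a(u, v) + ⟪u, v⟫`. -/
structure ClosedForm (H : Type*) [NormedAddCommGroup H] [InnerProductSpace ℝ H] where
  domain : Submodule ℝ H
  form : LinearMap.BilinForm ℝ domain
  symm : ∀ u v, form u v = form v u
  nonneg : ∀ u, 0 ≤ form u u
  dense : Dense (domain : Set H)
  closed : ∀ u : ℕ → domain,
    (∀ ε > 0, ∃ N, ∀ m ≥ N, ∀ n ≥ N, form (u m - u n) (u m - u n) + ‖u m - u n‖ ^ 2 < ε) →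
    ∃ v : domain, Tendsto (fun n => form (u n - v) (u n - v) + ‖u n - v‖ ^ 2) atTop (𝓝 0)

theorem riesz_of_bilin {X : Type*} [AddCommGroup X] [Module ℝ X] (B : LinearMap.BilinForm ℝ X)
    (hs : ∀ u v, B u v = B v u) (hp : ∀ u, 0 ≤ B u u) (hd : ∀ u, B u u = 0 → u = 0)
    (hc : ∀ u : ℕ → X, (∀ ε > 0, ∃ N, ∀ m ≥ N, ∀ n ≥ N, B (u m - u n) (u m - u n) < ε) →
      ∃ v, Tendsto (fun n => B (u n - v) (u n - v)) atTop (𝓝 0))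
    (φ : X →ₗ[ℝ] ℝ) (C : ℝ) (hφ : ∀ v, φ v ^ 2 ≤ C ^ 2 * B v v) (hC : 0 ≤ C) :
    ∃ u, ∀ v, B u v = φ v := by
  let core : InnerProductSpace.Core ℝ X :=
    { inner := fun u v => B u v
      conj_inner_symm := fun u v => by simpa using hs v u
      re_inner_nonneg := fun u => by simpa using hp u
      add_left := fun u v w => by simp
      smul_left := fun u v r => by simp
      definite := hd }
  let _ : NormedAddCommGroup X := core.toNormedAddCommGroup
  let _ : InnerProductSpace ℝ X := InnerProductSpace.ofCore core.toCore
  have hin : ∀ u v : X, inner ℝ u v = B u v := fun u v => rfl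
  have hnorm : ∀ u : X, ‖u‖ ^ 2 = B u u := fun u => by
    rw [← real_inner_self_eq_norm_sq, hin]
  have : CompleteSpace X := by
    refine Metric.complete_of_cauchySeq_tendsto fun u hu => ?_
    obtain ⟨v, hv⟩ := hc u (fun ε hε => by
      obtain ⟨N, hN⟩ := Metric.cauchySeq_iff.1 hu (Real.sqrt ε) (Real.sqrt_pos.2 hε)
      refine ⟨N, fun m hm n hn => ?_⟩
      have h1 := hN m hm n hn
      rw [dist_eq_norm] at h1
      rw [← hnorm]
      exact (Real.lt_sqrt (norm_nonneg _)).1 h1)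
    refine ⟨v, ?_⟩
    rw [tendsto_iff_norm_sub_tendsto_zero]
    have h2 : Tendsto (fun n => Real.sqrt (B (u n - v) (u n - v))) atTop (𝓝 0) := by
      simpa using hv.sqrt
    refine h2.congr fun n => ?_
    rw [← hnorm, Real.sqrt_sq (norm_nonneg _)]
  let ψ : StrongDual ℝ X := φ.mkContinuous C (fun v => by
    rw [Real.norm_eq_abs]
    refine abs_le_of_sq_le_sq ?_ (by positivity)
    rw [mul_pow, hnorm]; exact hφ v)
  refine ⟨(InnerProductSpace.toDual ℝ X).symm ψ, fun v => ?_⟩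
  rw [← hin, InnerProductSpace.toDual_symm_apply]
  rfl

namespace ClosedForm

section

variable {H : Type*} [NormedAddCommGroup H] [InnerProductSpace ℝ H]

theorem exists_weak_solution [CompleteSpace H] (a : ClosedForm H) {l : ℝ} (hl : 0 < l) (f : H) :
    ∃ u : a.domain, ∀ v : a.domain, a.form u v + l * ⟪(u : H), v⟫ = ⟪f, v⟫ := by
  let I : LinearMap.BilinForm ℝ a.domain := (innerₗ H).compl₁₂ a.domain.subtype a.domain.subtype
  have hI : ∀ u v : a.domain, I u v = ⟪(u : H), v⟫ := fun u v => rfl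
  have hB : ∀ u v : a.domain, (a.form + l • I) u v = a.form u v + l * ⟪(u : H), v⟫ :=
    fun u v => by simp [hI]
  have hB' : ∀ u : a.domain, (a.form + l • I) u u = a.form u u + l * ‖u‖ ^ 2 :=
    fun u => by rw [hB, real_inner_self_eq_norm_sq]; rfl
  obtain ⟨u, hu⟩ := riesz_of_bilin (a.form + l • I)
    (fun u v => by rw [hB, hB, a.symm, real_inner_comm])
    (fun u => by rw [hB']; have := a.nonneg u; positivity)
    (fun u h => by
      rw [hB'] at h
      have h1 := a.nonneg u
      have h2 : 0 ≤ l * ‖u‖ ^ 2 := by positivity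
      have h3 : l * ‖u‖ ^ 2 = 0 := by linarith
      simpa [hl.ne'] using h3)
    (fun u h => by
      simp only [hB'] at h ⊢
      obtain ⟨v, hv⟩ := a.closed u (fun ε hε => by
        obtain ⟨N, hN⟩ := h (min 1 l * ε) (by positivity)
        refine ⟨N, fun m hm n hn => ?_⟩
        have h1 := hN m hm n hn
        have h2 := a.nonneg (u m - u n)
        have h3 : 0 ≤ ‖u m - u n‖ ^ 2 := by positivity
        have h5 : min 1 l * (a.form (u m - u n) (u m - u n)) ≤
          1 * a.form (u m - u n) (u m - u n) := by gcongr; exact min_le_left _ _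
        have h6 : min 1 l * ‖u m - u n‖ ^ 2 ≤ l * ‖u m - u n‖ ^ 2 := by
          gcongr; exact min_le_right _ _
        have h4 : 0 < min 1 l := by positivity
        refine lt_of_mul_lt_mul_left ?_ h4.le
        linarith)
      refine ⟨v, ?_⟩
      have h0 : Tendsto (fun n => max 1 l * (a.form (u n - v) (u n - v) + ‖u n - v‖ ^ 2)) atTop
          (𝓝 0) := by simpa using hv.const_mul (max 1 l)
      refine squeeze_zero (fun n => ?_) (fun n => ?_) h0
      · have := a.nonneg (u n - v); positivity
      · have h1 := a.nonneg (u n - v)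
        have h5 : 1 * (a.form (u n - v) (u n - v)) ≤
          max 1 l * a.form (u n - v) (u n - v) := by gcongr; exact le_max_left _ _
        have h6 : l * ‖u n - v‖ ^ 2 ≤ max 1 l * ‖u n - v‖ ^ 2 := by
          gcongr; exact le_max_right _ _
        linarith)
    ((innerₗ H f).comp a.domain.subtype) (‖f‖ / Real.sqrt l)
    (fun v => by
      rw [hB', div_pow, Real.sq_sqrt hl.le]
      have h1 : |⟪f, (v : H)⟫| ≤ ‖f‖ * ‖(v : H)‖ := abs_real_inner_le_norm _ _
      have h2 : ⟪f, (v : H)⟫ ^ 2 ≤ (‖f‖ * ‖(v : H)‖) ^ 2 := by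
        rw [← sq_abs]; gcongr
      have h3 : ‖f‖ ^ 2 / l * (a.form v v + l * ‖v‖ ^ 2) =
        ‖f‖ ^ 2 / l * a.form v v + (‖f‖ * ‖(v : H)‖) ^ 2 := by
        rw [Submodule.coe_norm]; field_simp
      have h4 : 0 ≤ ‖f‖ ^ 2 / l * a.form v v := by have := a.nonneg v; positivity
      rw [h3]
      change ⟪f, (v : H)⟫ ^ 2 ≤ _
      linarith)
    (by positivity)
  exact ⟨u, fun v => by rw [← hB, hu]; rfl⟩

theorem weak_solution_unique (a : ClosedForm H) {l : ℝ} (hl : 0 < l) {f : H} {u w : a.domain}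
    (hu : ∀ v : a.domain, a.form u v + l * ⟪(u : H), v⟫ = ⟪f, v⟫)
    (hw : ∀ v : a.domain, a.form w v + l * ⟪(w : H), v⟫ = ⟪f, v⟫) : u = w := by
  have h : a.form (u - w) (u - w) + l * ‖((u - w : a.domain) : H)‖ ^ 2 = 0 := by
    rw [← real_inner_self_eq_norm_sq]
    have h1 := hu (u - w)
    have h2 := hw (u - w)
    have h3 : a.form (u - w) (u - w) = a.form u (u - w) - a.form w (u - w) := by simp
    have h4 : ⟪((u - w : a.domain) : H), ((u - w : a.domain) : H)⟫ =
      ⟪(u : H), ((u - w : a.domain) : H)⟫ - ⟪(w : H), ((u - w : a.domain) : H)⟫ := by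
      rw [← inner_sub_left]; rfl
    rw [h3, h4]; linarith
  have h1 := a.nonneg (u - w)
  have h2 : 0 ≤ l * ‖((u - w : a.domain) : H)‖ ^ 2 := by positivity
  have h3 : l * ‖((u - w : a.domain) : H)‖ ^ 2 = 0 := by linarith
  have h4 : u - w = 0 := by simpa [hl.ne', -AddSubgroupClass.coe_sub] using h3
  exact sub_eq_zero.1 h4

theorem exists_resolvent [CompleteSpace H] (a : ClosedForm H) {l : ℝ} (hl : 0 < l) :
    ∃ G : H →L[ℝ] H, ∀ f, ∃ hf : G f ∈ a.domain, ∀ v : a.domain,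
      a.form ⟨G f, hf⟩ v + l * ⟪G f, v⟫ = ⟪f, v⟫ := by
  choose g hg using a.exists_weak_solution hl
  let L : H →ₗ[ℝ] H :=
    { toFun := fun f => g f
      map_add' := fun f f' => by
        rw [← Submodule.coe_add]
        congr 1
        refine a.weak_solution_unique hl (hg _) fun v => ?_
        have h1 := hg f v
        have h2 := hg f' v
        simp only [map_add, LinearMap.add_apply, Submodule.coe_add, inner_add_left]
        linarith
      map_smul' := fun c f => by
        rw [RingHom.id_apply, ← Submodule.coe_smul]
        congr 1
        refine a.weak_solution_unique hl (hg _) fun v => ?_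
        have h1 := hg f v
        simp only [map_smul, LinearMap.smul_apply, Submodule.coe_smul, inner_smul_left, smul_eq_mul,
          conj_trivial]
        linear_combination c * h1 }
  refine ⟨L.mkContinuous (1 / l) fun f => ?_, fun f => ⟨(g f).2, hg f⟩⟩
  change ‖(g f : H)‖ ≤ _
  have h1 := hg f (g f)
  rw [real_inner_self_eq_norm_sq] at h1
  have h2 := a.nonneg (g f)
  have h3 := real_inner_le_norm f (g f : H)
  rcases (norm_nonneg (g f : H)).eq_or_lt with h0 | h0
  · rw [← h0]; positivity
  · have h4 : (l * ‖(g f : H)‖) * ‖(g f : H)‖ ≤ ‖f‖ * ‖(g f : H)‖ := by nlinarith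
    have h5 := le_of_mul_le_mul_right h4 h0
    rw [div_mul_eq_mul_div, one_mul, le_div_iff₀ hl]; linarith

/-- The resolvent: `G_l f` is the element of the domain of `a` with
`a(G_l f, v) + l ⟪G_l f, v⟫ = ⟪f, v⟫` for all `v` in the domain of `a`. -/
noncomputable def resolvent [CompleteSpace H] (a : ClosedForm H) (l : ℝ) (hl : 0 < l) :
    H →L[ℝ] H :=
  Classical.choose (a.exists_resolvent hl)

theorem resolvent_mem [CompleteSpace H] (a : ClosedForm H) {l : ℝ} (hl : 0 < l) (f : H) :
    a.resolvent l hl f ∈ a.domain :=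
  (Classical.choose_spec (a.exists_resolvent hl) f).1

theorem form_resolvent [CompleteSpace H] (a : ClosedForm H) {l : ℝ} (hl : 0 < l) (f : H)
    (v : a.domain) :
    a.form ⟨a.resolvent l hl f, a.resolvent_mem hl f⟩ v + l * ⟪a.resolvent l hl f, v⟫ = ⟪f, v⟫ :=
  (Classical.choose_spec (a.exists_resolvent hl) f).2 v

/-- Pairs `(u, g)` with `u` in the domain of `a` and `a(u, v) = -⟪g, v⟫` for all `v` there. -/
def generatorGraph (a : ClosedForm H) : Submodule ℝ (H × H) where
  carrier := {p | ∃ hp : p.1 ∈ a.domain, ∀ v : a.domain, a.form ⟨p.1, hp⟩ v = -⟪p.2, (v : H)⟫}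
  zero_mem' := ⟨a.domain.zero_mem, fun v => by
    have : (⟨(0 : H × H).1, a.domain.zero_mem⟩ : a.domain) = 0 := rfl
    rw [this]; simp⟩
  add_mem' := by
    rintro p q ⟨hp, hp'⟩ ⟨hq, hq'⟩
    refine ⟨a.domain.add_mem hp hq, fun v => ?_⟩
    have : (⟨(p + q).1, a.domain.add_mem hp hq⟩ : a.domain) = ⟨p.1, hp⟩ + ⟨q.1, hq⟩ := rfl
    rw [this, map_add, LinearMap.add_apply, hp', hq', Prod.snd_add, inner_add_left]
    ring
  smul_mem' := by
    rintro c p ⟨hp, hp'⟩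
    refine ⟨a.domain.smul_mem c hp, fun v => ?_⟩
    have : (⟨(c • p).1, a.domain.smul_mem c hp⟩ : a.domain) = c • ⟨p.1, hp⟩ := rfl
    rw [this, map_smul, LinearMap.smul_apply, hp', Prod.smul_snd, inner_smul_left]
    simp

/-- The infinitesimal generator `A` of `a`: the self-adjoint operator with `a(u, v) = -⟪A u, v⟫`. -/
noncomputable def generator (a : ClosedForm H) : H →ₗ.[ℝ] H :=
  a.generatorGraph.toLinearPMap

theorem generator_graph (a : ClosedForm H) : a.generator.graph = a.generatorGraph := by
  refine Submodule.toLinearPMap_graph_eq _ ?_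
  rintro ⟨x, g⟩ ⟨hx, h⟩ hx'
  dsimp only at hx hx' h ⊢
  subst hx'
  have h0 : ∀ v : H, v ∈ a.domain → ⟪g, v⟫ = 0 := fun v hv => by
    have h1 := h ⟨v, hv⟩
    have : (⟨0, hx⟩ : a.domain) = 0 := rfl
    rw [this] at h1
    simpa using h1
  exact a.dense.eq_zero_of_inner_left (𝕜 := ℝ) (fun v hv => h0 v hv)

theorem mem_generator_graph (a : ClosedForm H) (u g : H) : (u, g) ∈ a.generator.graph ↔
    ∃ hu : u ∈ a.domain, ∀ v : a.domain, a.form ⟨u, hu⟩ v = -⟪g, (v : H)⟫ := by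
  rw [generator_graph]; rfl

end

end ClosedForm


section

variable {H : Type*} [NormedAddCommGroup H] [InnerProductSpace ℝ H]

/-- A strongly continuous semigroup of symmetric contractions. -/
structure IsSymmContractionSemigroup (T : ℝ≥0 → H →L[ℝ] H) : Prop where
  zero : T 0 = ContinuousLinearMap.id ℝ H
  add : ∀ s t, T (s + t) = (T s).comp (T t)
  norm_le : ∀ t, ‖T t‖ ≤ 1
  symm : ∀ t f g, ⟪T t f, g⟫ = ⟪f, T t g⟫
  continuous : ∀ f, Continuous fun t => T t f

/-- `A` is the infinitesimal generator of `T`: `f` lies in the domain of `A` and `A f = g` exactly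
when `(T t f - f) / t` tends to `g` as `t` decreases to `0`. -/
def IsGeneratorOf (A : H →ₗ.[ℝ] H) (T : ℝ≥0 → H →L[ℝ] H) : Prop :=
  ∀ f g, (f, g) ∈ A.graph ↔ Tendsto (fun t : ℝ≥0 => (t : ℝ)⁻¹ • (T t f - f)) (𝓝[>] 0) (𝓝 g)

end

namespace ClosedForm

section

variable {H : Type*} [NormedAddCommGroup H] [InnerProductSpace ℝ H] [CompleteSpace H]

theorem hasDerivAt_exp_apply (B : H →L[ℝ] H) (f : H) (t : ℝ) :
    HasDerivAt (fun t : ℝ => NormedSpace.exp (t • B) f) (NormedSpace.exp (t • B) (B f)) t := by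
  simpa using (hasDerivAt_exp_smul_const (𝕂 := ℝ) B t).clm_apply (hasDerivAt_const t f)

theorem norm_exp_apply_le (B : H →L[ℝ] H) (hB : ∀ f, ⟪B f, f⟫ ≤ 0) {t : ℝ} (ht : 0 ≤ t) (f : H) :
    ‖NormedSpace.exp (t • B) f‖ ≤ ‖f‖ := by
  have hd : ∀ s : ℝ, HasDerivAt (fun s : ℝ => ‖NormedSpace.exp (s • B) f‖ ^ 2)
      (2 * ⟪NormedSpace.exp (s • B) f, NormedSpace.exp (s • B) (B f)⟫) s := fun s =>
    (hasDerivAt_exp_apply B f s).norm_sq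
  have hcomm : ∀ s : ℝ, NormedSpace.exp (s • B) (B f) = B (NormedSpace.exp (s • B) f) := fun s => by
    have h := ((Commute.refl B).smul_left s).exp_left
    exact congrArg (fun C : H →L[ℝ] H => C f) h
  have hanti : Antitone (fun s : ℝ => ‖NormedSpace.exp (s • B) f‖ ^ 2) := by
    refine antitone_of_deriv_nonpos (fun s => (hd s).differentiableAt) fun s => ?_
    rw [(hd s).deriv, hcomm, real_inner_comm]
    have := hB (NormedSpace.exp (s • B) f)
    linarith
  have h := hanti ht
  simp only [zero_smul, NormedSpace.exp_zero, one_apply_eq_self] at h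
  exact le_of_sq_le_sq h (norm_nonneg _)

theorem norm_exp_sub_exp_le (B C : H →L[ℝ] H) (hB : ∀ f, ⟪B f, f⟫ ≤ 0) (hC : ∀ f, ⟪C f, f⟫ ≤ 0)
    (hBC : Commute B C) {t : ℝ} (ht : 0 ≤ t) (f : H) :
    ‖NormedSpace.exp (t • B) f - NormedSpace.exp (t • C) f‖ ≤ t * ‖B f - C f‖ := by
  have hd : ∀ s : ℝ, HasDerivAt
      (fun s : ℝ => NormedSpace.exp (s • B) (NormedSpace.exp ((t - s) • C) f))
      (NormedSpace.exp (s • B) (NormedSpace.exp ((t - s) • C) (B f - C f))) s := fun s => by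
    have h1 := hasDerivAt_exp_smul_const (𝕂 := ℝ) B s
    have h2 := (hasDerivAt_exp_apply C f (t - s)).scomp s ((hasDerivAt_id s).const_sub t)
    have h3 := h1.clm_apply h2
    refine h3.congr_deriv ?_
    have hc : B (NormedSpace.exp ((t - s) • C) f) = NormedSpace.exp ((t - s) • C) (B f) := by
      have h := (hBC.smul_right (t - s)).exp_right
      exact congrArg (fun C : H →L[ℝ] H => C f) h
    simp only [mul_apply_eq_comp, hc, map_sub, neg_smul, one_smul, map_neg,
      Function.comp_apply]
    abel
  have h := norm_image_sub_le_of_norm_deriv_le_segment' (a := 0) (b := t) (C := ‖B f - C f‖)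
    (fun s _ => (hd s).hasDerivWithinAt) (fun s hs =>
      (norm_exp_apply_le B hB hs.1 _).trans (norm_exp_apply_le C hC (sub_nonneg.2 hs.2.le) _))
    t ⟨ht, le_rfl⟩
  simpa [mul_comm] using h

theorem norm_exp_sub_id_le (B : H →L[ℝ] H) (hB : ∀ f, ⟪B f, f⟫ ≤ 0) {t : ℝ} (ht : 0 ≤ t) (f : H) :
    ‖NormedSpace.exp (t • B) f - f‖ ≤ t * ‖B f‖ := by
  simpa using norm_exp_sub_exp_le B 0 hB (by simp) (Commute.zero_right B) ht f

theorem norm_exp_sub_linear_le (B : H →L[ℝ] H) (hB : ∀ f, ⟪B f, f⟫ ≤ 0) {t : ℝ} (ht : 0 ≤ t)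
    (f g h : H) : ‖NormedSpace.exp (t • B) f - f - t • g‖ ≤
      (‖B f - g‖ + 2 * ‖g - h‖ + t * ‖B h‖) * t := by
  have hd : ∀ s : ℝ, HasDerivAt (fun s : ℝ => NormedSpace.exp (s • B) f - s • g)
      (NormedSpace.exp (s • B) (B f) - g) s := fun s => by
    have h1 := (hasDerivAt_id s).smul_const g
    rw [one_smul] at h1
    exact (hasDerivAt_exp_apply B f s).sub h1
  have hb : ∀ s ∈ Set.Ico (0 : ℝ) t, ‖NormedSpace.exp (s • B) (B f) - g‖ ≤
      ‖B f - g‖ + 2 * ‖g - h‖ + t * ‖B h‖ := fun s hs => by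
    have e : NormedSpace.exp (s • B) (B f) - g = NormedSpace.exp (s • B) (B f - g) +
        NormedSpace.exp (s • B) (g - h) + (NormedSpace.exp (s • B) h - h) + (h - g) := by
      simp only [map_sub]; abel
    rw [e]
    refine (norm_add₄_le).trans ?_
    have h1 := norm_exp_apply_le B hB hs.1 (B f - g)
    have h2 := norm_exp_apply_le B hB hs.1 (g - h)
    have h3 := norm_exp_sub_id_le B hB hs.1 h
    have h4 : s * ‖B h‖ ≤ t * ‖B h‖ := by gcongr; exact hs.2.le
    rw [norm_sub_rev h g]
    linarith
  have h := norm_image_sub_le_of_norm_deriv_le_segment' (a := 0) (b := t)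
    (fun s _ => (hd s).hasDerivWithinAt) hb t ⟨ht, le_rfl⟩
  simp only [zero_smul, NormedSpace.exp_zero, one_apply_eq_self, sub_zero] at h
  rwa [sub_right_comm]

/-- Bounded symmetric dissipative commuting operators `B n` that converge pointwise on the domain
of an operator with a dense domain and with `1 - A` surjective define a semigroup. -/
theorem exists_semigroup_of_approx (B : ℕ → H →L[ℝ] H) (D : Submodule ℝ (H × H))
    (hB : ∀ n f, ⟪B n f, f⟫ ≤ 0) (hsym : ∀ n, IsSelfAdjoint (B n))
    (hcomm : ∀ n m, Commute (B n) (B m))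
    (hlim : ∀ f g, (f, g) ∈ D → Tendsto (fun n => B n f) atTop (𝓝 g))
    (hdense : Dense {f : H | ∃ g, (f, g) ∈ D}) (hsurj : ∀ f, ∃ u g, (u, g) ∈ D ∧ u - g = f) :
    ∃ T : ℝ≥0 → H →L[ℝ] H, IsSymmContractionSemigroup T ∧ ∀ f g, (f, g) ∈ D ↔
      Tendsto (fun t : ℝ≥0 => (t : ℝ)⁻¹ • (T t f - f)) (𝓝[>] 0) (𝓝 g) := by
  let S : ℕ → ℝ≥0 → H →L[ℝ] H := fun n t => NormedSpace.exp ((t : ℝ) • B n)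
  have hS : ∀ n t f, ‖S n t f‖ ≤ ‖f‖ := fun n t f => norm_exp_apply_le (B n) (hB n) t.2 f
  have hcau : ∀ t f, CauchySeq fun n => S n t f := by
    intro t f
    rw [Metric.cauchySeq_iff']
    intro ε hε
    obtain ⟨f', hf', hff⟩ := Metric.dense_iff.1 hdense f (ε / 4) (by positivity)
    obtain ⟨g, hg⟩ := hff
    rw [Metric.mem_ball, dist_eq_norm] at hf'
    obtain ⟨N, hN⟩ := Metric.cauchySeq_iff'.1 (hlim _ _ hg).cauchySeq (ε / (4 * (t + 1)))
      (by positivity)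
    refine ⟨N, fun n hn => ?_⟩
    have h1 := hN n hn
    rw [dist_eq_norm] at h1 ⊢
    have e : S n t f - S N t f = (S n t f' - S N t f') - S n t (f' - f) + S N t (f' - f) := by
      simp only [map_sub]; abel
    have h2 : ‖S n t f' - S N t f'‖ ≤ t * ‖B n f' - B N f'‖ :=
      norm_exp_sub_exp_le _ _ (hB n) (hB N) (hcomm n N) t.2 f'
    have h3 : (t : ℝ) * ‖B n f' - B N f'‖ ≤ ε / 4 := by
      have h5 : (t : ℝ) * ‖B n f' - B N f'‖ ≤ (t + 1) * (ε / (4 * (t + 1))) := by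
        gcongr; simp
      have h6 : ((t : ℝ) + 1) * (ε / (4 * (t + 1))) = ε / 4 := by
        have : (t : ℝ) + 1 ≠ 0 := by positivity
        field_simp
      linarith
    have h7 := hS n t (f' - f)
    have h8 := hS N t (f' - f)
    rw [e]
    have h9 := norm_add_le ((S n t f' - S N t f') - S n t (f' - f)) (S N t (f' - f))
    have h10 := norm_sub_le (S n t f' - S N t f') (S n t (f' - f))
    linarith
  choose T₀ hT₀ using fun t f => cauchySeq_tendsto_of_complete (hcau t f)
  have hT₀n : ∀ t f, ‖T₀ t f‖ ≤ ‖f‖ := fun t f =>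
    le_of_tendsto (hT₀ t f).norm (Eventually.of_forall fun n => hS n t f)
  let T : ℝ≥0 → H →L[ℝ] H := fun t =>
    LinearMap.mkContinuous
      { toFun := T₀ t
        map_add' := fun f g => tendsto_nhds_unique (hT₀ t (f + g))
          (by simpa only [map_add] using (hT₀ t f).add (hT₀ t g))
        map_smul' := fun c f => tendsto_nhds_unique (hT₀ t (c • f))
          (by simpa only [map_smul, RingHom.id_apply] using (hT₀ t f).const_smul c) } 1
      (fun f => by rw [one_mul]; exact hT₀n t f)
  have hT : ∀ t f, Tendsto (fun n => S n t f) atTop (𝓝 (T t f)) := hT₀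
  have hTn : ∀ t f, ‖T t f‖ ≤ ‖f‖ := hT₀n
  let _ : NormedAlgebra ℚ (H →L[ℝ] H) := NormedAlgebra.restrictScalars ℚ ℝ _
  have hzero : T 0 = ContinuousLinearMap.id ℝ H := by
    ext f
    refine tendsto_nhds_unique (hT 0 f) ?_
    simp [S]
  have hadd : ∀ s t, T (s + t) = (T s).comp (T t) := by
    intro s t
    ext f
    refine tendsto_nhds_unique (hT (s + t) f) ?_
    have e : ∀ n, S n (s + t) f = S n s (S n t f - T t f) + S n s (T t f) := fun n => by
      have h1 : S n (s + t) = S n s * S n t := by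
        simp only [S, NNReal.coe_add, add_smul]
        exact NormedSpace.exp_add_of_commute
          (((Commute.refl (B n)).smul_left _).smul_right _)
      rw [h1, ← map_add, sub_add_cancel]; rfl
    simp only [e]
    have h2 : Tendsto (fun n => S n s (S n t f - T t f)) atTop (𝓝 0) := by
      refine squeeze_zero_norm (fun n => hS n s _) ?_
      have := (hT t f).sub_const (T t f)
      rw [sub_self] at this
      simpa using this.norm
    simpa using h2.add (hT s (T t f))
  have hsymm : ∀ t f g, ⟪T t f, g⟫ = ⟪f, T t g⟫ := by
    intro t f g
    refine tendsto_nhds_unique ((hT t f).inner tendsto_const_nhds)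
      (Tendsto.congr (fun n => ?_) ((tendsto_const_nhds (x := f)).inner (hT t g)))
    have h1 : IsSelfAdjoint (S n t) := ((IsSelfAdjoint.all (t : ℝ)).smul (hsym n)).exp
    exact ((ContinuousLinearMap.isSelfAdjoint_iff_isSymmetric.1 h1) f g).symm
  have hlip : ∀ f g, (f, g) ∈ D → ∀ t, ‖T t f - f‖ ≤ t * ‖g‖ := by
    intro f g hfg t
    exact le_of_tendsto_of_tendsto ((hT t f).sub_const f).norm
      ((hlim f g hfg).norm.const_mul (t : ℝ))
      (Eventually.of_forall fun n => norm_exp_sub_id_le (B n) (hB n) t.2 f)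
  have hlip2 : ∀ f g, (f, g) ∈ D → ∀ s t : ℝ≥0, s ≤ t → ‖T t f - T s f‖ ≤ dist t s * ‖g‖ := by
    intro f g hfg s t hst
    obtain ⟨r, rfl⟩ := exists_add_of_le hst
    have e : T (s + r) f - T s f = T s (T r f - f) := by rw [hadd, map_sub]; rfl
    rw [e]
    refine (hTn _ _).trans ((hlip f g hfg r).trans (le_of_eq ?_))
    simp [NNReal.dist_eq]
  have hcont : ∀ f, Continuous fun t => T t f := by
    intro f
    rw [Metric.continuous_iff]
    intro s ε hε
    obtain ⟨f', hf', hff⟩ := Metric.dense_iff.1 hdense f (ε / 4) (by positivity)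
    obtain ⟨g, hg⟩ := hff
    rw [Metric.mem_ball, dist_eq_norm] at hf'
    refine ⟨ε / (4 * (‖g‖ + 1)), by positivity, fun t ht => ?_⟩
    have h1 : ‖T t f' - T s f'‖ ≤ dist t s * ‖g‖ := by
      rcases le_total s t with h | h
      · exact hlip2 f' g hg s t h
      · rw [norm_sub_rev, dist_comm]; exact hlip2 f' g hg t s h
    have h2 : dist t s * ‖g‖ ≤ ε / 4 := by
      have h5 : dist t s * ‖g‖ ≤ (ε / (4 * (‖g‖ + 1))) * (‖g‖ + 1) := by
        gcongr; simp
      have h6 : (ε / (4 * (‖g‖ + 1))) * (‖g‖ + 1) = ε / 4 := by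
        field_simp
      linarith
    have e : T t f - T s f = (T t f' - T s f') - T t (f' - f) + T s (f' - f) := by
      simp only [map_sub]; abel
    have h7 := hTn t (f' - f)
    have h8 := hTn s (f' - f)
    rw [dist_eq_norm, e]
    have h9 := norm_add_le ((T t f' - T s f') - T t (f' - f)) (T s (f' - f))
    have h10 := norm_sub_le (T t f' - T s f') (T t (f' - f))
    linarith
  have hgen : ∀ f g, (f, g) ∈ D →
      Tendsto (fun t : ℝ≥0 => (t : ℝ)⁻¹ • (T t f - f)) (𝓝[>] 0) (𝓝 g) := by
    intro f g hfg
    rw [Metric.tendsto_nhds]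
    intro ε hε
    obtain ⟨h, hh, hhh⟩ := Metric.dense_iff.1 hdense g (ε / 4) (by positivity)
    obtain ⟨k, hk⟩ := hhh
    rw [Metric.mem_ball, dist_eq_norm, norm_sub_rev] at hh
    have hest : ∀ t, ‖T t f - f - (t : ℝ) • g‖ ≤ (0 + 2 * ‖g - h‖ + t * ‖k‖) * t := fun t => by
      refine le_of_tendsto_of_tendsto (((hT t f).sub_const f).sub_const ((t : ℝ) • g)).norm
        ((Tendsto.add (Tendsto.add ?_ tendsto_const_nhds)
          ((hlim h k hk).norm.const_mul (t : ℝ))).mul_const (t : ℝ))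
        (Eventually.of_forall fun n => norm_exp_sub_linear_le (B n) (hB n) t.2 f g h)
      have := (hlim f g hfg).sub_const g
      rw [sub_self] at this
      simpa using this.norm
    have hsmall : ∀ᶠ t : ℝ≥0 in 𝓝[>] 0, (t : ℝ) * ‖k‖ < ε / 2 := by
      have h1 : Tendsto (fun t : ℝ≥0 => (t : ℝ) * ‖k‖) (𝓝 0) (𝓝 0) := by
        have : Continuous fun t : ℝ≥0 => (t : ℝ) * ‖k‖ := by fun_prop
        simpa using this.tendsto 0
      exact (h1.mono_left nhdsWithin_le_nhds).eventually_lt_const (by positivity)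
    filter_upwards [hsmall, self_mem_nhdsWithin] with t ht ht0
    have ht0' : (0 : ℝ) < t := NNReal.coe_pos.2 ht0
    have e : (t : ℝ)⁻¹ • (T t f - f) - g = (t : ℝ)⁻¹ • (T t f - f - (t : ℝ) • g) := by
      rw [smul_sub _ _ ((t : ℝ) • g), inv_smul_smul₀ ht0'.ne']
    rw [dist_eq_norm, e, norm_smul, norm_inv, Real.norm_of_nonneg ht0'.le,
      inv_mul_lt_iff₀ ht0']
    have h1 := hest t
    have h2 : (0 + 2 * ‖g - h‖ + t * ‖k‖) * t < ε * t := by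
      apply mul_lt_mul_of_pos_right _ ht0'
      linarith
    linarith
  refine ⟨T, ⟨hzero, hadd, fun t => ?_, hsymm, hcont⟩, fun f g => ⟨hgen f g, fun h => ?_⟩⟩
  · exact ContinuousLinearMap.opNorm_le_bound _ zero_le_one fun f => by
      rw [one_mul]; exact hTn t f
  · obtain ⟨u, k, huk, hu⟩ := hsurj (f - g)
    have h1 := h.sub (hgen u k huk)
    have e : g - k = f - u := by
      have : g - k = f - u + ((u - k) - (f - g)) := by abel
      rw [this, hu, sub_self, add_zero]
    have h2 : Tendsto (fun t : ℝ≥0 => (t : ℝ)⁻¹ • (T t (f - u) - (f - u))) (𝓝[>] 0)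
        (𝓝 (f - u)) := by
      rw [e] at h1
      refine h1.congr fun t => ?_
      rw [← smul_sub, map_sub]
      congr 1; abel
    have h3 : ⟪f - u, f - u⟫ ≤ 0 := by
      refine le_of_tendsto (h2.inner (tendsto_const_nhds (x := f - u)))
        (Eventually.of_forall fun t => ?_)
      rw [inner_smul_left, inner_sub_left, real_inner_self_eq_norm_sq]
      have h4 := real_inner_le_norm (T t (f - u)) (f - u)
      have h5 := hTn t (f - u)
      have h6 : ‖T t (f - u)‖ * ‖f - u‖ ≤ ‖f - u‖ * ‖f - u‖ := by gcongr
      have h7 : (0 : ℝ) ≤ (t : ℝ)⁻¹ := by positivity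
      simp only [conj_trivial]
      exact mul_nonpos_of_nonneg_of_nonpos h7 (by nlinarith)
    have h4 : f - u = 0 := real_inner_self_nonpos.1 h3
    have h5 : g - k = 0 := e.trans h4
    rw [sub_eq_zero] at h4 h5
    rw [h4, h5]; exact huk

end

end ClosedForm
namespace ClosedForm

section

variable {H : Type*} [NormedAddCommGroup H] [InnerProductSpace ℝ H] [CompleteSpace H]

theorem resolvent_eq_of_weak (a : ClosedForm H) {l : ℝ} (hl : 0 < l) {f : H} (u : a.domain)
    (hu : ∀ v : a.domain, a.form u v + l * ⟪(u : H), v⟫ = ⟪f, v⟫) : a.resolvent l hl f = u :=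
  congrArg Subtype.val (a.weak_solution_unique hl (a.form_resolvent hl f) hu)

theorem norm_resolvent_le (a : ClosedForm H) {l : ℝ} (hl : 0 < l) (f : H) :
    l * ‖a.resolvent l hl f‖ ≤ ‖f‖ := by
  have h1 := a.form_resolvent hl f ⟨_, a.resolvent_mem hl f⟩
  rw [real_inner_self_eq_norm_sq] at h1
  have h2 := a.nonneg ⟨_, a.resolvent_mem hl f⟩
  have h3 := real_inner_le_norm f (a.resolvent l hl f)
  rcases (norm_nonneg (a.resolvent l hl f)).eq_or_lt with h0 | h0
  · rw [← h0]; simp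
  · refine le_of_mul_le_mul_right ?_ h0
    dsimp only at h1
    linarith [sq (‖a.resolvent l hl f‖)]

theorem resolvent_symm (a : ClosedForm H) {l : ℝ} (hl : 0 < l) (f g : H) :
    ⟪a.resolvent l hl f, g⟫ = ⟪f, a.resolvent l hl g⟫ := by
  have h1 := a.form_resolvent hl f ⟨_, a.resolvent_mem hl g⟩
  have h2 := a.form_resolvent hl g ⟨_, a.resolvent_mem hl f⟩
  rw [a.symm] at h2
  dsimp only at h1 h2
  rw [real_inner_comm g, ← h1, ← h2, real_inner_comm (a.resolvent l hl f)]

theorem resolvent_sub_resolvent (a : ClosedForm H) {l m : ℝ} (hl : 0 < l) (hm : 0 < m) (f : H) :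
    a.resolvent m hm f - a.resolvent l hl f = (l - m) • a.resolvent l hl (a.resolvent m hm f) := by
  have h := a.resolvent_eq_of_weak hl (f := f + (l - m) • a.resolvent m hm f)
    ⟨_, a.resolvent_mem hm f⟩ (fun v => by
      have h1 := a.form_resolvent hm f v
      rw [inner_add_left, real_inner_smul_left]
      linear_combination h1)
  rw [map_add, map_smul] at h
  dsimp only at h
  nth_rewrite 1 [← h]
  abel

theorem resolvent_comm (a : ClosedForm H) {l m : ℝ} (hl : 0 < l) (hm : 0 < m) :
    Commute (a.resolvent l hl) (a.resolvent m hm) := by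
  rcases eq_or_ne l m with rfl | hlm
  · exact Commute.refl _
  · ext f
    have h1 := a.resolvent_sub_resolvent hl hm f
    have h2 := a.resolvent_sub_resolvent hm hl f
    refine smul_right_injective H (sub_ne_zero.2 hlm) ?_
    change (l - m) • a.resolvent l hl (a.resolvent m hm f) =
      (l - m) • a.resolvent m hm (a.resolvent l hl f)
    rw [← h1, ← neg_sub m l, neg_smul, ← h2]
    abel

theorem mul_norm_resolvent_sub_le (a : ClosedForm H) {l : ℝ} (hl : 0 < l) (f : a.domain) :
    l * ‖l • a.resolvent l hl (f : H) - f‖ ^ 2 ≤ a.form f f := by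
  set u : a.domain := ⟨_, a.resolvent_mem hl (f : H)⟩ with hu
  have hform := a.form_resolvent hl (f : H) (l • u - f)
  rw [← hu] at hform
  have e1 : a.form u (l • u - f) = l * a.form u u - a.form u f := by simp
  have e2 : ((l • u - f : a.domain) : H) = l • a.resolvent l hl (f : H) - f := rfl
  have e3 : ‖l • a.resolvent l hl (f : H) - f‖ ^ 2 =
      l * ⟪a.resolvent l hl (f : H), ((l • u - f : a.domain) : H)⟫ -
        ⟪(f : H), ((l • u - f : a.domain) : H)⟫ := by
    rw [← real_inner_self_eq_norm_sq, e2, inner_sub_left, real_inner_smul_left]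
  have e4 : 0 ≤ a.form (l • u - f) (l • u - f) := a.nonneg _
  have e5 : a.form (l • u - f) (l • u - f) =
      l ^ 2 * a.form u u - 2 * l * a.form u f + a.form f f := by
    simp [a.symm f u]; ring
  have e6 : 0 ≤ l ^ 2 * a.form u u := mul_nonneg (sq_nonneg l) (a.nonneg u)
  have e7 : 0 ≤ a.form f f := a.nonneg f
  rw [e3]
  have e8 : l * ⟪a.resolvent l hl (f : H), ((l • u - f : a.domain) : H)⟫ -
        ⟪(f : H), ((l • u - f : a.domain) : H)⟫ = a.form u f - l * a.form u u := by linarith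
  rw [e8]
  nlinarith

theorem tendsto_resolvent (a : ClosedForm H) (f : H) :
    Tendsto (fun n : ℕ => ((n : ℝ) + 1) • a.resolvent ((n : ℝ) + 1) n.cast_add_one_pos f) atTop
      (𝓝 f) := by
  rw [Metric.tendsto_atTop]
  intro ε hε
  obtain ⟨h, hh, hD⟩ := Metric.dense_iff.1 a.dense f (ε / 4) (by positivity)
  rw [Metric.mem_ball, dist_eq_norm] at hh
  obtain ⟨N, hN⟩ := exists_nat_gt (a.form ⟨h, hD⟩ ⟨h, hD⟩ / (ε / 4) ^ 2)
  refine ⟨N, fun n hn => ?_⟩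
  have hp : (0 : ℝ) < (n : ℝ) + 1 := n.cast_add_one_pos
  set G := a.resolvent ((n : ℝ) + 1) hp
  have h1 : ((n : ℝ) + 1) * ‖((n : ℝ) + 1) • G h - h‖ ^ 2 ≤ a.form ⟨h, hD⟩ ⟨h, hD⟩ :=
    a.mul_norm_resolvent_sub_le hp ⟨h, hD⟩
  have h2 : a.form ⟨h, hD⟩ ⟨h, hD⟩ < ((n : ℝ) + 1) * (ε / 4) ^ 2 := by
    rw [div_lt_iff₀ (by positivity)] at hN
    refine hN.trans_le ?_
    gcongr
    have : (N : ℝ) ≤ n := by exact_mod_cast hn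
    linarith
  have h3 : ‖((n : ℝ) + 1) • G h - h‖ < ε / 4 := by
    have h4 := lt_of_mul_lt_mul_left (h1.trans_lt h2) hp.le
    exact lt_of_pow_lt_pow_left₀ 2 (by positivity) h4
  have h5 : ‖((n : ℝ) + 1) • G (h - f)‖ ≤ ‖h - f‖ := by
    rw [norm_smul, Real.norm_of_nonneg hp.le]
    exact a.norm_resolvent_le hp _
  have e : ((n : ℝ) + 1) • G f - f =
      (((n : ℝ) + 1) • G h - h) - ((n : ℝ) + 1) • G (h - f) + (h - f) := by
    rw [map_sub, smul_sub]; abel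
  rw [dist_eq_norm, e]
  have h9 := norm_add_le ((((n : ℝ) + 1) • G h - h) - ((n : ℝ) + 1) • G (h - f)) (h - f)
  have h10 := norm_sub_le (((n : ℝ) + 1) • G h - h) (((n : ℝ) + 1) • G (h - f))
  linarith

theorem resolvent_mem_generatorGraph (a : ClosedForm H) {l : ℝ} (hl : 0 < l) (f : H) :
    (a.resolvent l hl f, l • a.resolvent l hl f - f) ∈ a.generatorGraph :=
  ⟨a.resolvent_mem hl f, fun v => by
    have := a.form_resolvent hl f v
    dsimp only
    rw [inner_sub_left, real_inner_smul_left]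
    linarith⟩

theorem resolvent_of_mem_generatorGraph (a : ClosedForm H) {l : ℝ} (hl : 0 < l) {f g : H}
    (h : (f, g) ∈ a.generatorGraph) : l • a.resolvent l hl f - f = a.resolvent l hl g := by
  obtain ⟨hf, h⟩ := h
  have h1 := a.resolvent_eq_of_weak hl (f := l • f - g) ⟨f, hf⟩ (fun v => by
    have := h v
    dsimp only at this ⊢
    rw [inner_sub_left, real_inner_smul_left, this]
    ring)
  rw [map_sub, map_smul] at h1
  dsimp only at h1
  rw [sub_eq_iff_eq_add, add_comm, ← sub_eq_iff_eq_add]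
  exact h1

/-- There is a strongly continuous symmetric contraction semigroup generated by `a.generator`. -/
theorem exists_semigroup (a : ClosedForm H) :
    ∃ T : ℝ≥0 → H →L[ℝ] H, IsSymmContractionSemigroup T ∧ IsGeneratorOf a.generator T := by
  let r : ℕ → ℝ := fun n => (n : ℝ) + 1
  have hr : ∀ n, 0 < r n := fun n => n.cast_add_one_pos
  let B : ℕ → H →L[ℝ] H := fun n => r n • (r n • a.resolvent (r n) (hr n) - 1)
  have hlim : ∀ f : H, Tendsto (fun n => r n • a.resolvent (r n) (hr n) f) atTop (𝓝 f) :=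
    a.tendsto_resolvent
  unfold IsGeneratorOf
  simp only [generator_graph]
  refine exists_semigroup_of_approx B a.generatorGraph (fun n f => ?_) (fun n => ?_)
    (fun n m => ?_) (fun f g hfg => ?_) ?_ (fun f => ?_)
  · change ⟪r n • (r n • a.resolvent (r n) (hr n) f - f), f⟫ ≤ 0
    rw [real_inner_smul_left, inner_sub_left, real_inner_smul_left, real_inner_self_eq_norm_sq]
    have h1 := real_inner_le_norm (a.resolvent (r n) (hr n) f) f
    have h2 := a.norm_resolvent_le (hr n) f
    have h3 : r n * ⟪a.resolvent (r n) (hr n) f, f⟫ ≤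
        r n * (‖a.resolvent (r n) (hr n) f‖ * ‖f‖) := mul_le_mul_of_nonneg_left h1 (hr n).le
    have h4 : r n * ‖a.resolvent (r n) (hr n) f‖ * ‖f‖ ≤ ‖f‖ * ‖f‖ := by gcongr
    exact mul_nonpos_of_nonneg_of_nonpos (hr n).le (by nlinarith)
  · have h : IsSelfAdjoint (a.resolvent (r n) (hr n)) :=
      ContinuousLinearMap.isSelfAdjoint_iff_isSymmetric.2 fun f g => a.resolvent_symm (hr n) f g
    exact (IsSelfAdjoint.all (r n)).smul
      (((IsSelfAdjoint.all (r n)).smul h).sub (IsSelfAdjoint.one _))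
  · have h := a.resolvent_comm (hr n) (hr m)
    exact ((((h.smul_left _).smul_right _).sub_left (Commute.one_left _)).sub_right
      (Commute.one_right _)).smul_left _ |>.smul_right _
  · refine (hlim g).congr fun n => ?_
    rw [← a.resolvent_of_mem_generatorGraph (hr n) hfg]
    rfl
  · intro f
    refine mem_closure_of_tendsto (hlim f) (Eventually.of_forall fun n => ?_)
    exact ⟨_, a.generatorGraph.smul_mem (r n) (a.resolvent_mem_generatorGraph (hr n) f)⟩
  · exact ⟨_, _, a.resolvent_mem_generatorGraph one_pos f, by simp⟩

/-- The strongly continuous symmetric contraction semigroup associated with `a`: the one whose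
infinitesimal generator is `a.generator`. -/
noncomputable def semigroup (a : ClosedForm H) : ℝ≥0 → H →L[ℝ] H :=
  Classical.choose a.exists_semigroup

theorem isSymmContractionSemigroup_semigroup (a : ClosedForm H) :
    IsSymmContractionSemigroup a.semigroup :=
  (Classical.choose_spec a.exists_semigroup).1

theorem isGeneratorOf_semigroup (a : ClosedForm H) : IsGeneratorOf a.generator a.semigroup :=
  (Classical.choose_spec a.exists_semigroup).2

end

section

variable {H : Type*} [NormedAddCommGroup H] [InnerProductSpace ℝ H]

open Classical in
/-- The extended quadratic form: `a(u, u)` on the domain of `a`, and `∞` off the domain. -/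
noncomputable def energy (a : ClosedForm H) (u : H) : ℝ≥0∞ :=
  if hu : u ∈ a.domain then ENNReal.ofReal (a.form ⟨u, hu⟩ ⟨u, hu⟩) else ⊤

end

end ClosedForm

/-- Generalized Mosco convergence of the forms `a k` on `K k` to the form `b` on `H`, along maps
`E k` from `K k` to `H`. -/
structure MoscoConverges {K : ℕ → Type*} {H : Type*}
    [∀ k, NormedAddCommGroup (K k)] [∀ k, InnerProductSpace ℝ (K k)]
    [NormedAddCommGroup H] [InnerProductSpace ℝ H]
    (E : ∀ k, K k →L[ℝ] H) (a : ∀ k, ClosedForm (K k)) (b : ClosedForm H) : Prop where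
  liminf : ∀ (v : ∀ k, K k) (u : H),
    (∀ g : H, Tendsto (fun k => ⟪E k (v k), g⟫) atTop (𝓝 ⟪u, g⟫)) →
    b.energy u ≤ Filter.liminf (fun k => (a k).energy (v k)) atTop
  limsup : ∀ u : H, ∃ v : ∀ k, K k, Tendsto (fun k => E k (v k)) atTop (𝓝 u) ∧
    Filter.limsup (fun k => (a k).energy (v k)) atTop ≤ b.energy u

/-! Everything is compared with resolvent convergence (iv). Since `π_k E_k = 1`, the `E_k` are
isometries and the projections `E_k π_k` tend strongly to the identity, so a single form and a
sequence of forms can be compared inside `H`.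

(i) and (iv): `G_λ f` minimizes the strictly convex functional `a(v,v) + λ‖v‖² - 2⟪f,v⟫`. Mosco
convergence makes these functionals converge variationally, and their quadratic growth at the
minimizer (`mul_norm_sub_resolvent_sq_le`) upgrades weak compactness to strong convergence
(`exists_subseq_tendsto_resolvent`). Conversely, `a` is recovered from resolvents: pairing with `λ
G_λ u` in the form is an inner product in `H` (`form_regularize`), and `a(u,u)` is bounded by the
supremum of the energies of these regularizations, also when `u` is outside the domain
(`energy_le_of_forall_regularize`).

(ii) and (iv) form the Trotter-Kato theorem. The resolvent is the Laplace transform of the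
semigroup; in the other direction, a dissipativity estimate controls the failure of the approximate
resolvents to intertwine the semigroups (`norm_semigroup_resolvent_sub_sq_le`).

(iii) and (iv): resolvents supply the approximating `f_k`; conversely `(λ - A)C_0` is dense because
`C_0` is a core, and on it the resolvent is explicit. -/

/-! ### Weak limits, uniformity on compact sets and diagonal sequences. -/

theorem exists_subseq_tendsto_inner {H : Type*} [NormedAddCommGroup H] [InnerProductSpace ℝ H]
    [CompleteSpace H] (x : ℕ → H) (M : ℝ) (hx : ∀ n, ‖x n‖ ≤ M) :
    ∃ (u : H) (φ : ℕ → ℕ), StrictMono φ ∧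
      ∀ g : H, Tendsto (fun n => ⟪x (φ n), g⟫) atTop (𝓝 ⟪u, g⟫) := by
  -- `H` need not be separable, but the closed span of the sequence is, which gives sequential
  -- weak-* compactness of balls in its dual. Test vectors outside `W` are replaced by their
  -- projections.
  let W : Submodule ℝ H := (Submodule.span ℝ (Set.range x)).topologicalClosure
  have hxW : ∀ n, x n ∈ W := fun n =>
    Submodule.le_topologicalClosure _ (Submodule.subset_span ⟨n, rfl⟩)
  have hsep : TopologicalSpace.SeparableSpace W :=
    ((Set.countable_range x).isSeparable.span (R := ℝ)).closure.separableSpace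
  have hW : CompleteSpace W := (Submodule.isClosed_topologicalClosure _).completeSpace_coe
  let y : ℕ → WeakDual ℝ W := fun n =>
    StrongDual.toWeakDual (InnerProductSpace.toDual ℝ W ⟨x n, hxW n⟩)
  obtain ⟨ψ, -, φ, hφ, hlim⟩ := WeakDual.isSeqCompact_closedBall ℝ W 0 M (x := y) (fun n => by
    change InnerProductSpace.toDual ℝ W ⟨x n, hxW n⟩ ∈ Metric.closedBall 0 M
    rw [mem_closedBall_zero_iff, LinearIsometryEquiv.norm_map]
    exact hx n)
  refine ⟨(InnerProductSpace.toDual ℝ W).symm (WeakDual.toStrongDual ψ), φ, hφ, fun g => ?_⟩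
  have h1 := ((WeakDual.eval_continuous (𝕜 := ℝ) (W.orthogonalProjectionOnto g)).tendsto ψ).comp hlim
  have h2 : ∀ w : W, ⟪(w : H), g⟫ = ⟪w, W.orthogonalProjectionOnto g⟫ := fun w => by
    rw [Submodule.inner_orthogonalProjectionOnto_eq_of_mem_left]
  rw [h2, InnerProductSpace.toDual_symm_apply]
  refine h1.congr fun n => ?_
  rw [show x (φ n) = ((⟨x (φ n), hxW _⟩ : W) : H) from rfl, h2]
  rfl

theorem bddAbove_norm_of_tendsto_inner {H : Type*} [NormedAddCommGroup H] [InnerProductSpace ℝ H]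
    [CompleteSpace H] {x : ℕ → H} {u : H}
    (h : ∀ g : H, Tendsto (fun n => ⟪x n, g⟫) atTop (𝓝 ⟪u, g⟫)) : ∃ M, ∀ n, ‖x n‖ ≤ M := by
  obtain ⟨M, hM⟩ := banach_steinhaus (g := fun n => innerSL ℝ (x n)) (fun g => by
    obtain ⟨C, hC⟩ := (h g).norm.bddAbove_range
    exact ⟨C, fun n => hC ⟨n, rfl⟩⟩)
  exact ⟨M, fun n => by simpa using hM n⟩

theorem tendsto_inner_of_tendsto_of_weak {H : Type*} [NormedAddCommGroup H]
    [InnerProductSpace ℝ H] [CompleteSpace H] {x y : ℕ → H} {u v : H}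
    (h : ∀ g : H, Tendsto (fun n => ⟪x n, g⟫) atTop (𝓝 ⟪u, g⟫)) (hy : Tendsto y atTop (𝓝 v)) :
    Tendsto (fun n => ⟪x n, y n⟫) atTop (𝓝 ⟪u, v⟫) := by
  obtain ⟨M, hM⟩ := bddAbove_norm_of_tendsto_inner h
  have h1 : Tendsto (fun n => ⟪x n, y n - v⟫) atTop (𝓝 0) := by
    have h2 : Tendsto (fun n => M * ‖y n - v‖) atTop (𝓝 0) := by
      simpa using (tendsto_iff_norm_sub_tendsto_zero.1 hy).const_mul M
    refine squeeze_zero_norm (fun n => (norm_inner_le_norm _ _).trans ?_) h2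
    exact mul_le_mul_of_nonneg_right (hM n) (norm_nonneg _)
  have h2 := h1.add (h v)
  rw [zero_add] at h2
  refine h2.congr fun n => ?_
  rw [← inner_add_right, sub_add_cancel]

/-- The common bound `M` reduces the claim to a finite net. Applied to the orbit `{T_t f : t ≤ s}`,
it makes pointwise convergence of resolvents uniform in `t`. -/
theorem eventually_forall_norm_lt_of_isCompact {X Y : Type*} [SeminormedAddCommGroup X]
    [NormedSpace ℝ X] [SeminormedAddCommGroup Y] [NormedSpace ℝ Y] {B : ℕ → X →L[ℝ] Y} {M : ℝ}
    (hB : ∀ k x, ‖B k x‖ ≤ M * ‖x‖) (hlim : ∀ x, Tendsto (fun k => B k x) atTop (𝓝 0))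
    {S : Set X} (hS : IsCompact S) {ε : ℝ} (hε : 0 < ε) :
    ∀ᶠ k in atTop, ∀ x ∈ S, ‖B k x‖ < ε := by
  have hδ : 0 < ε / (2 * (|M| + 1)) := by positivity
  obtain ⟨t, -, ht, hcov⟩ := hS.finite_cover_balls hδ
  have h : ∀ᶠ k in atTop, ∀ x ∈ t, ‖B k x‖ < ε / 2 :=
    (eventually_all_finite ht).2 fun x _ =>
      (tendsto_zero_iff_norm_tendsto_zero.1 (hlim x)).eventually_lt_const (by positivity)
  filter_upwards [h] with k hk x hx
  obtain ⟨y, hy, hxy⟩ := Set.mem_iUnion₂.1 (hcov hx)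
  rw [Metric.mem_ball, dist_eq_norm] at hxy
  have h1 : ‖B k (x - y)‖ ≤ ε / 2 := by
    calc ‖B k (x - y)‖ ≤ M * ‖x - y‖ := hB _ _
      _ ≤ (|M| + 1) * (ε / (2 * (|M| + 1))) := by
        gcongr
        linarith [le_abs_self M]
      _ = ε / 2 := by
        have : |M| + 1 ≠ 0 := by positivity
        field_simp
  have h2 := norm_add_le (B k (x - y)) (B k y)
  rw [← map_add, sub_add_cancel] at h2
  linarith [hk y hy]

theorem exists_diagonal_of_eventually {Q : ℕ → ℕ → Prop} (h : ∀ n, ∀ᶠ k in atTop, Q n k) :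
    ∃ N : ℕ → ℕ, Tendsto N atTop atTop ∧ ∀ᶠ k in atTop, Q (N k) k := by
  classical
  -- `N k` is the largest `n ≤ k` with `Q n k`, so no monotonicity in `n` is needed. The default
  -- value `0` is harmless, since `Q 0 k` also holds eventually.
  refine ⟨fun k => Nat.findGreatest (fun n => Q n k) k, tendsto_atTop.2 fun n => ?_, ?_⟩
  · filter_upwards [h n, eventually_ge_atTop n] with k hk hn
    exact Nat.le_findGreatest hn hk
  · filter_upwards [h 0] with k hk
    exact Nat.findGreatest_spec (P := fun n => Q n k) (Nat.zero_le k) hk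

/-! ### Isometric approximation of the limit space. -/

/-- `P k` is the adjoint of the isometric embedding `E k`, and `E k ∘ P k` tends strongly to the
identity. -/
structure IsometricApproximation {K : ℕ → Type*} {H : Type*}
    [∀ k, NormedAddCommGroup (K k)] [∀ k, InnerProductSpace ℝ (K k)]
    [NormedAddCommGroup H] [InnerProductSpace ℝ H]
    (E : ∀ k, K k →L[ℝ] H) (P : ∀ k, H →L[ℝ] K k) : Prop where
  inner_left : ∀ k v f, ⟪E k v, f⟫ = ⟪v, P k f⟫
  leftInverse : ∀ k v, P k (E k v) = v
  tendsto : ∀ f, Tendsto (fun k => E k (P k f)) atTop (𝓝 f)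

namespace IsometricApproximation

section

variable {K : ℕ → Type*} {H : Type*}
    [∀ k, NormedAddCommGroup (K k)] [∀ k, InnerProductSpace ℝ (K k)]
    [NormedAddCommGroup H] [InnerProductSpace ℝ H]
    {E : ∀ k, K k →L[ℝ] H} {P : ∀ k, H →L[ℝ] K k}

theorem inner_map (h : IsometricApproximation E P) (k : ℕ) (v w : K k) :
    ⟪E k v, E k w⟫ = ⟪v, w⟫ := by
  rw [h.inner_left, h.leftInverse]

theorem norm_map (h : IsometricApproximation E P) (k : ℕ) (v : K k) : ‖E k v‖ = ‖v‖ := by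
  rw [← sq_eq_sq₀ (norm_nonneg _) (norm_nonneg _), ← real_inner_self_eq_norm_sq, h.inner_map,
    real_inner_self_eq_norm_sq]

theorem norm_adjoint_le (h : IsometricApproximation E P) (k : ℕ) (f : H) : ‖P k f‖ ≤ ‖f‖ := by
  have h1 := real_inner_le_norm (E k (P k f)) f
  rw [h.inner_left, real_inner_self_eq_norm_sq, h.norm_map] at h1
  rcases (norm_nonneg (P k f)).eq_or_lt with h0 | h0
  · rw [← h0]; positivity
  · exact le_of_mul_le_mul_left (by linarith [sq ‖P k f‖]) h0

/-- `E_k π_k` is an orthogonal projection, so by Pythagoras `‖E_k π_k f - f‖² = ‖f‖² - ‖π_k f‖²`: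
convergence of norms already forces strong convergence. -/
theorem of_adjoint [∀ k, CompleteSpace (K k)] [CompleteSpace H]
    (hP : ∀ k, P k = ContinuousLinearMap.adjoint (E k)) (hPE : ∀ k v, P k (E k v) = v)
    (hlim : ∀ f, Tendsto (fun k => ‖P k f‖) atTop (𝓝 ‖f‖)) : IsometricApproximation E P := by
  have hin : ∀ k v f, ⟪E k v, f⟫ = ⟪v, P k f⟫ := fun k v f => by
    rw [hP, ContinuousLinearMap.adjoint_inner_right]
  refine ⟨hin, hPE, fun f => ?_⟩
  have h1 : ∀ k, ‖E k (P k f) - f‖ ^ 2 = ‖f‖ ^ 2 - ‖P k f‖ ^ 2 := fun k => by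
    rw [norm_sub_sq_real, hin, real_inner_self_eq_norm_sq, ← real_inner_self_eq_norm_sq (E k _),
      hin, hPE, real_inner_self_eq_norm_sq]
    ring
  have h2 : Tendsto (fun k => ‖E k (P k f) - f‖ ^ 2) atTop (𝓝 0) := by
    simp only [h1]
    rw [← sub_self (‖f‖ ^ 2)]
    exact ((hlim f).pow 2).const_sub _
  rw [tendsto_iff_norm_sub_tendsto_zero]
  simpa using h2.sqrt

end

end IsometricApproximation

/-! ### Generator, resolvent and semigroup of a single form. -/

namespace ClosedForm

theorem inner_nonpos_of_mem_generatorGraph {H : Type*} [NormedAddCommGroup H]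
    [InnerProductSpace ℝ H] {a : ClosedForm H} {f g : H}
    (h : (f, g) ∈ a.generatorGraph) : ⟪g, f⟫ ≤ 0 := by
  obtain ⟨hf, h⟩ := h
  have h1 := h ⟨f, hf⟩
  have h2 := a.nonneg ⟨f, hf⟩
  dsimp only at h1
  linarith

section

variable {H : Type*} [NormedAddCommGroup H] [InnerProductSpace ℝ H] [CompleteSpace H]

/-- Turns membership in the graph of an unbounded operator into an equation between bounded ones,
from which closedness and commutation with the semigroup can be read off. -/
theorem mem_generatorGraph_iff_resolvent (a : ClosedForm H) {l : ℝ} (hl : 0 < l) {f g : H} :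
    (f, g) ∈ a.generatorGraph ↔ f = a.resolvent l hl (l • f - g) := by
  constructor
  · intro h
    rw [map_sub, map_smul, ← a.resolvent_of_mem_generatorGraph hl h, sub_sub_cancel]
  · intro h
    have h1 := a.resolvent_mem_generatorGraph hl (l • f - g)
    rwa [← h, sub_sub_cancel] at h1

theorem isClosed_generatorGraph (a : ClosedForm H) : IsClosed (a.generatorGraph : Set (H × H)) := by
  have h : (a.generatorGraph : Set (H × H)) =
      {p | p.1 = a.resolvent 1 one_pos ((1 : ℝ) • p.1 - p.2)} := by
    ext ⟨f, g⟩
    exact a.mem_generatorGraph_iff_resolvent one_pos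
  rw [h]
  exact isClosed_eq (by fun_prop) (by fun_prop)

theorem tendsto_slope_semigroup {a : ClosedForm H} {f g : H} (h : (f, g) ∈ a.generatorGraph) :
    Tendsto (fun t : ℝ≥0 => (t : ℝ)⁻¹ • (a.semigroup t f - f)) (𝓝[>] 0) (𝓝 g) :=
  (a.isGeneratorOf_semigroup f g).1 (by rwa [generator_graph])

theorem norm_semigroup_le (a : ClosedForm H) (t : ℝ≥0) (f : H) : ‖a.semigroup t f‖ ≤ ‖f‖ := by
  simpa using (a.semigroup t).le_of_opNorm_le
    (a.isSymmContractionSemigroup_semigroup.norm_le t) f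

theorem semigroup_mem_generatorGraph {a : ClosedForm H} {f g : H} (t : ℝ≥0)
    (h : (f, g) ∈ a.generatorGraph) : (a.semigroup t f, a.semigroup t g) ∈ a.generatorGraph := by
  rw [← generator_graph, a.isGeneratorOf_semigroup]
  refine (((a.semigroup t).continuous.tendsto g).comp (tendsto_slope_semigroup h)).congr
    fun s => ?_
  have hadd := a.isSymmContractionSemigroup_semigroup.add
  have e : a.semigroup t (a.semigroup s f) = a.semigroup s (a.semigroup t f) := by
    rw [← ContinuousLinearMap.comp_apply, ← ContinuousLinearMap.comp_apply, ← hadd, ← hadd,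
      add_comm]
  simp [e]

theorem resolvent_semigroup (a : ClosedForm H) {l : ℝ} (hl : 0 < l) (t : ℝ≥0) (f : H) :
    a.resolvent l hl (a.semigroup t f) = a.semigroup t (a.resolvent l hl f) := by
  have h := (a.mem_generatorGraph_iff_resolvent hl).1
    (semigroup_mem_generatorGraph t (a.resolvent_mem_generatorGraph hl f))
  rw [h, ← map_smul, ← map_sub, sub_sub_cancel]

/-- The generator is defined by a limit as time decreases to `0`, so the semigroup law yields a
right derivative. With continuity of orbits, that is enough for the mean value inequalities below.
-/
theorem hasDerivWithinAt_semigroup {a : ClosedForm H} {f g : H} (h : (f, g) ∈ a.generatorGraph)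
    {t : ℝ} (ht : 0 ≤ t) : HasDerivWithinAt (fun s : ℝ => a.semigroup s.toNNReal f)
      (a.semigroup t.toNNReal g) (Set.Ici t) t := by
  rw [← hasDerivWithinAt_Ioi_iff_Ici, hasDerivWithinAt_iff_tendsto_slope' (by simp)]
  have h1 : Tendsto (fun s : ℝ => (s - t).toNNReal) (𝓝[>] t) (𝓝[>] 0) := by
    refine tendsto_nhdsWithin_iff.2 ⟨?_, ?_⟩
    · have : Continuous fun s : ℝ => (s - t).toNNReal := by fun_prop
      simpa using (this.tendsto t).mono_left nhdsWithin_le_nhds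
    · filter_upwards [self_mem_nhdsWithin] with s hs
      simpa using hs
  refine (((a.semigroup t.toNNReal).continuous.tendsto g).comp
    ((tendsto_slope_semigroup h).comp h1)).congr' ?_
  filter_upwards [self_mem_nhdsWithin] with s hs
  have hs' : t < s := hs
  have e : s.toNNReal = t.toNNReal + (s - t).toNNReal := by
    rw [← Real.toNNReal_add ht (by linarith), add_sub_cancel]
  rw [slope_def_module, e, a.isSymmContractionSemigroup_semigroup.add]
  simp [Real.coe_toNNReal _ (sub_nonneg.2 hs'.le)]

theorem continuous_semigroup_toNNReal (a : ClosedForm H) (f : H) :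
    Continuous fun s : ℝ => a.semigroup s.toNNReal f :=
  (a.isSymmContractionSemigroup_semigroup.continuous f).comp continuous_real_toNNReal

theorem denseRange_resolvent (a : ClosedForm H) {l : ℝ} (hl : 0 < l) :
    DenseRange (a.resolvent l hl) := fun f => by
  refine mem_closure_of_tendsto (a.tendsto_resolvent f) (Eventually.of_forall fun n => ?_)
  -- The range of `G_l` is the domain of the generator, whatever `l` is; it therefore contains the
  -- approximants `(n+1) G_{n+1} f`.
  have h := (a.mem_generatorGraph_iff_resolvent hl).1
    (a.generatorGraph.smul_mem ((n : ℝ) + 1)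
      (a.resolvent_mem_generatorGraph (l := (n : ℝ) + 1) n.cast_add_one_pos f))
  exact ⟨_, h.symm⟩

end

end ClosedForm

/-! ### Resolvent convergence compared with generators, and deduced from semigroups. -/

namespace IsometricApproximation

section

variable {K : ℕ → Type*} {H : Type*}
    [∀ k, NormedAddCommGroup (K k)] [∀ k, InnerProductSpace ℝ (K k)] [∀ k, CompleteSpace (K k)]
    [NormedAddCommGroup H] [InnerProductSpace ℝ H] [CompleteSpace H]
    {E : ∀ k, K k →L[ℝ] H} {P : ∀ k, H →L[ℝ] K k} {a : ∀ k, ClosedForm (K k)} {b : ClosedForm H}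

/-- With `g = f - Af`, so that `f = G_1 g`, the choice is `f_k = G^{(k)}_1 π_k g`, for which
`A^{(k)} f_k = f_k - π_k g`. -/
theorem tendsto_generator_of_tendsto_resolvent (h : IsometricApproximation E P)
    (hG : ∀ f, Tendsto (fun k => E k ((a k).resolvent 1 one_pos (P k f))) atTop
      (𝓝 (b.resolvent 1 one_pos f))) (f : b.generator.domain) :
    ∃ u : ∀ k, (a k).generator.domain, Tendsto (fun k => E k (u k)) atTop (𝓝 (f : H)) ∧
      Tendsto (fun k => E k ((a k).generator (u k))) atTop (𝓝 (b.generator f)) := by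
  have hf : ((f : H), b.generator f) ∈ b.generatorGraph := by
    rw [← ClosedForm.generator_graph]; exact b.generator.mem_graph f
  set g := (f : H) - b.generator f
  have hfg : (f : H) = b.resolvent 1 one_pos g := by
    have := (b.mem_generatorGraph_iff_resolvent one_pos).1 hf
    rwa [one_smul] at this
  have hmem : ∀ k, ((a k).resolvent 1 one_pos (P k g),
      (a k).resolvent 1 one_pos (P k g) - P k g) ∈ (a k).generator.graph := fun k => by
    have := (a k).resolvent_mem_generatorGraph one_pos (P k g)
    rwa [one_smul, ← ClosedForm.generator_graph] at this
  choose u hu hAu using fun k => (LinearPMap.mem_graph_iff _).1 (hmem k)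
  refine ⟨u, ?_, ?_⟩
  · rw [hfg]
    simpa only [hu] using hG g
  · have h1 := (hG g).sub (h.tendsto g)
    rw [← hfg, show (f : H) - g = b.generator f from sub_sub_cancel _ _] at h1
    refine h1.congr fun k => ?_
    rw [hAu, ← map_sub (E k)]

theorem tendsto_resolvent_of_dense (h : IsometricApproximation E P) {l : ℝ} (hl : 0 < l)
    {R : Set H} (hR : Dense R)
    (hG : ∀ f ∈ R, Tendsto (fun k => E k ((a k).resolvent l hl (P k f))) atTop
      (𝓝 (b.resolvent l hl f))) (f : H) :
    Tendsto (fun k => E k ((a k).resolvent l hl (P k f))) atTop (𝓝 (b.resolvent l hl f)) := by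
  rw [Metric.tendsto_atTop']
  intro ε hε
  obtain ⟨g, hg, hgR⟩ := Metric.dense_iff.1 hR f (l * (ε / 3)) (by positivity)
  rw [Metric.mem_ball, dist_eq_norm, norm_sub_rev] at hg
  obtain ⟨N, hN⟩ := Metric.tendsto_atTop'.1 (hG g hgR) (ε / 3) (by positivity)
  refine ⟨N, fun k hk => ?_⟩
  have h1 := hN k hk
  have h2 : ‖E k ((a k).resolvent l hl (P k (f - g)))‖ < ε / 3 := by
    rw [h.norm_map]
    refine lt_of_mul_lt_mul_left ?_ hl.le
    exact (((a k).norm_resolvent_le hl _).trans (h.norm_adjoint_le k _)).trans_lt hg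
  have h3 : ‖b.resolvent l hl (f - g)‖ < ε / 3 :=
    lt_of_mul_lt_mul_left ((b.norm_resolvent_le hl _).trans_lt hg) hl.le
  rw [dist_eq_norm] at h1 ⊢
  have e : E k ((a k).resolvent l hl (P k f)) - b.resolvent l hl f =
      E k ((a k).resolvent l hl (P k (f - g))) +
      (E k ((a k).resolvent l hl (P k g)) - b.resolvent l hl g) - b.resolvent l hl (f - g) := by
    simp only [map_sub]; abel
  rw [e]
  have h4 := norm_sub_le (E k ((a k).resolvent l hl (P k (f - g))) +
      (E k ((a k).resolvent l hl (P k g)) - b.resolvent l hl g)) (b.resolvent l hl (f - g))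
  have h5 := norm_add_le (E k ((a k).resolvent l hl (P k (f - g))))
      (E k ((a k).resolvent l hl (P k g)) - b.resolvent l hl g)
  linarith

/-- Over a core the graph of `A` is dense in the whole graph, so the vectors `g = l u - A u` with `u
∈ C` are dense. For such `g` the error between `u_k` and `G^{(k)}_l π_k g` is at most `l⁻¹ ‖g - E_k
(l u_k - A^{(k)} u_k)‖`. -/
theorem tendsto_resolvent_of_tendsto_generator (h : IsometricApproximation E P)
    {C : Submodule ℝ H} (hC : b.generator.HasCore C)
    (hA : ∀ f : b.generator.domain, (f : H) ∈ C → ∃ u : ∀ k, (a k).generator.domain,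
      Tendsto (fun k => E k (u k)) atTop (𝓝 (f : H)) ∧
      Tendsto (fun k => E k ((a k).generator (u k))) atTop (𝓝 (b.generator f)))
    {l : ℝ} (hl : 0 < l) (f : H) :
    Tendsto (fun k => E k ((a k).resolvent l hl (P k f))) atTop (𝓝 (b.resolvent l hl f)) := by
  have hle : b.generator.domRestrict C ≤ b.generator := LinearPMap.domRestrict_le
  have hgraph : closure ((b.generator.domRestrict C).graph : Set (H × H)) = b.generatorGraph := by
    have hcl : b.generator.IsClosed := by
      rw [LinearPMap.IsClosed, ClosedForm.generator_graph]
      exact b.isClosed_generatorGraph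
    have h1 := (hcl.isClosable.leIsClosable hle).graph_closure_eq_closure_graph
    rw [hC.closure_eq, ClosedForm.generator_graph] at h1
    rw [← h1]; rfl
  let Φ : H × H → H := fun p => l • p.1 - p.2
  have hΦ : Continuous Φ := by fun_prop
  have hdense : Dense (Φ '' ((b.generator.domRestrict C).graph : Set (H × H))) := fun g => by
    refine image_closure_subset_closure_image hΦ ?_
    rw [hgraph]
    exact ⟨_, b.resolvent_mem_generatorGraph hl g, sub_sub_cancel _ _⟩
  refine h.tendsto_resolvent_of_dense hl hdense ?_ f
  rintro _ ⟨⟨u, g⟩, hug, rfl⟩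
  have hug' := LinearPMap.le_graph_of_le hle hug
  obtain ⟨u', rfl, rfl⟩ := (LinearPMap.mem_graph_iff _).1 hug'
  obtain ⟨w, hw1, hw2⟩ := hA u' (by
    obtain ⟨y, hy, -⟩ := (LinearPMap.mem_graph_iff _).1 hug
    dsimp only at hy
    rw [← hy]
    exact y.2.1)
  dsimp only [Φ]
  rw [← (b.mem_generatorGraph_iff_resolvent hl).1
    (by rw [← ClosedForm.generator_graph]; exact hug')]
  set g := l • (u' : H) - b.generator u'
  have hE : Tendsto (fun k => E k (l • (w k : K k) - (a k).generator (w k))) atTop (𝓝 g) := by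
    simpa only [map_sub, map_smul] using (hw1.const_smul l).sub hw2
  have hd : Tendsto (fun k => E k ((a k).resolvent l hl
      (P k (g - E k (l • (w k : K k) - (a k).generator (w k)))))) atTop (𝓝 0) := by
    have h1 : Tendsto (fun k => l⁻¹ * ‖g - E k (l • (w k : K k) - (a k).generator (w k))‖) atTop
        (𝓝 0) := by
      simpa [norm_sub_rev] using (tendsto_iff_norm_sub_tendsto_zero.1 hE).const_mul l⁻¹
    refine squeeze_zero_norm (fun k => ?_) h1
    rw [h.norm_map, le_inv_mul_iff₀ hl]
    exact ((a k).norm_resolvent_le hl _).trans (h.norm_adjoint_le k _)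
  have h2 := hw1.add hd
  rw [add_zero] at h2
  refine h2.congr fun k => ?_
  have hk : ((w k : K k), (a k).generator (w k)) ∈ (a k).generatorGraph := by
    rw [← ClosedForm.generator_graph]; exact (a k).generator.mem_graph _
  rw [map_sub (P k), h.leftInverse, map_sub ((a k).resolvent l hl),
    ← ((a k).mem_generatorGraph_iff_resolvent hl).1 hk, map_sub, add_sub_cancel]

/-- The Laplace transform formula in differential form. The function `φ t = e^{-lt} (E_k T^{(k)}_t
G^{(k)}_l π_k f - T_t G_l f)` has derivative `-e^{-lt} (E_k T^{(k)}_t π_k f - T_t f)`, small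
uniformly on `[0, s]`; `φ 0` is the resolvent error, and `φ s` is small for large `s` because of the
exponential. -/
theorem tendsto_resolvent_of_tendsto_semigroup (h : IsometricApproximation E P)
    (hT : ∀ (f : H) (s : ℝ≥0), TendstoUniformlyOn (fun k t => E k ((a k).semigroup t (P k f)))
      (fun t => b.semigroup t f) atTop (Set.Iic s)) {l : ℝ} (hl : 0 < l) (f : H) :
    Tendsto (fun k => E k ((a k).resolvent l hl (P k f))) atTop (𝓝 (b.resolvent l hl f)) := by
  set G := b.resolvent l hl f
  let Gk : ∀ k, K k := fun k => (a k).resolvent l hl (P k f)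
  have hexp : Tendsto (fun s : ℝ => Real.exp (-l * s) * (2 * (l⁻¹ * ‖f‖))) atTop (𝓝 0) := by
    have h1 : Tendsto (fun s : ℝ => Real.exp (-(l * s))) atTop (𝓝 0) :=
      Real.tendsto_exp_neg_atTop_nhds_zero.comp (tendsto_id.const_mul_atTop hl)
    simpa using h1.mul_const (2 * (l⁻¹ * ‖f‖))
  have hD : ∀ k (s : ℝ), 0 ≤ s →
      ‖E k ((a k).semigroup s.toNNReal (Gk k)) - b.semigroup s.toNNReal G‖ ≤
        2 * (l⁻¹ * ‖f‖) := fun k s _ => by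
    refine (norm_sub_le _ _).trans ?_
    have h1 := (a k).norm_semigroup_le s.toNNReal (Gk k)
    have h2 := b.norm_semigroup_le s.toNNReal G
    have h3 : ‖Gk k‖ ≤ l⁻¹ * ‖f‖ := by
      rw [le_inv_mul_iff₀ hl]
      exact ((a k).norm_resolvent_le hl _).trans (h.norm_adjoint_le k _)
    have h4 : ‖G‖ ≤ l⁻¹ * ‖f‖ := by
      rw [le_inv_mul_iff₀ hl]
      exact b.norm_resolvent_le hl _
    rw [h.norm_map]
    linarith
  rw [Metric.tendsto_nhds]
  intro ε hε
  obtain ⟨s, hs, hs0⟩ := ((hexp.eventually_lt_const (half_pos hε)).and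
    (eventually_ge_atTop 0)).exists
  -- Integrated over an interval of length `s`, this tolerance costs at most `ε / 2`; the `+ 1`
  -- covers `s = 0`.
  have hu := Metric.tendstoUniformlyOn_iff.1 (hT f s.toNNReal) (ε / (2 * (s + 1)))
    (by positivity)
  filter_upwards [hu] with k hk
  let φ : ℝ → H := fun t =>
    Real.exp (-l * t) • (E k ((a k).semigroup t.toNNReal (Gk k)) - b.semigroup t.toNNReal G)
  have hcont : Continuous φ := by
    have h1 := (E k).continuous.comp ((a k).continuous_semigroup_toNNReal (Gk k))
    have h2 := b.continuous_semigroup_toNNReal G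
    exact (by fun_prop : Continuous fun t : ℝ => Real.exp (-l * t)).smul (h1.sub h2)
  have hder : ∀ t ∈ Set.Ico 0 s, HasDerivWithinAt φ (-(Real.exp (-l * t) •
      (E k ((a k).semigroup t.toNNReal (P k f)) - b.semigroup t.toNNReal f))) (Set.Ici t) t := by
    intro t ht
    have h1 := (E k).hasFDerivAt.comp_hasDerivWithinAt t (ClosedForm.hasDerivWithinAt_semigroup
      ((a k).resolvent_mem_generatorGraph hl (P k f)) ht.1)
    have h2 := ClosedForm.hasDerivWithinAt_semigroup (b.resolvent_mem_generatorGraph hl f) ht.1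
    have h3 : HasDerivAt (fun t : ℝ => Real.exp (-l * t)) (Real.exp (-l * t) * (-l)) t := by
      simpa using ((hasDerivAt_id t).const_mul (-l)).exp
    refine (h3.hasDerivWithinAt.smul (h1.sub h2)).congr_deriv ?_
    simp only [map_sub, map_smul, Pi.sub_apply, Function.comp_apply]
    module
  have hbd : ∀ t ∈ Set.Ico 0 s, ‖-(Real.exp (-l * t) •
      (E k ((a k).semigroup t.toNNReal (P k f)) - b.semigroup t.toNNReal f))‖ ≤
      ε / (2 * (s + 1)) := by
    intro t ht
    rw [norm_neg, norm_smul, Real.norm_of_nonneg (Real.exp_pos _).le]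
    have h1 := hk t.toNNReal (Real.toNNReal_le_toNNReal ht.2.le)
    rw [dist_eq_norm, norm_sub_rev] at h1
    have h2 : Real.exp (-l * t) ≤ 1 := Real.exp_le_one_iff.2 (by nlinarith [ht.1])
    exact (mul_le_of_le_one_left (norm_nonneg _) h2).trans h1.le
  have h1 := norm_image_sub_le_of_norm_deriv_right_le_segment hcont.continuousOn hder hbd s
    ⟨hs0, le_rfl⟩
  have h2 : φ 0 = E k (Gk k) - G := by
    simp [φ, (a k).isSymmContractionSemigroup_semigroup.zero,
      b.isSymmContractionSemigroup_semigroup.zero]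
  have h3 : ‖φ s‖ ≤ Real.exp (-l * s) * (2 * (l⁻¹ * ‖f‖)) := by
    rw [norm_smul, Real.norm_of_nonneg (Real.exp_pos _).le]
    exact mul_le_mul_of_nonneg_left (hD k s hs0) (Real.exp_pos _).le
  have h4 : ε / (2 * (s + 1)) * (s - 0) ≤ ε / 2 := by
    rw [div_mul_eq_mul_div, div_le_iff₀ (by positivity)]
    nlinarith
  rw [dist_eq_norm]
  change ‖E k (Gk k) - G‖ < ε
  rw [← h2]
  have h5 := norm_sub_norm_le (φ 0) (φ s)
  rw [norm_sub_rev] at h5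
  linarith

end

end IsometricApproximation

/-! ### Trotter-Kato: semigroup convergence from resolvent convergence. -/

namespace IsometricApproximation

section

variable {K : ℕ → Type*} {H : Type*}
    [∀ k, NormedAddCommGroup (K k)] [∀ k, InnerProductSpace ℝ (K k)] [∀ k, CompleteSpace (K k)]
    [NormedAddCommGroup H] [InnerProductSpace ℝ H] [CompleteSpace H]
    {E : ∀ k, K k →L[ℝ] H} {P : ∀ k, H →L[ℝ] K k} {a : ∀ k, ClosedForm (K k)} {b : ClosedForm H}

theorem tendstoUniformlyOn_semigroup_of_dense (h : IsometricApproximation E P)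
    {R : Set H} (hR : Dense R) {s : ℝ≥0}
    (hT : ∀ f ∈ R, TendstoUniformlyOn (fun k t => E k ((a k).semigroup t (P k f)))
      (fun t => b.semigroup t f) atTop (Set.Iic s)) (f : H) :
    TendstoUniformlyOn (fun k t => E k ((a k).semigroup t (P k f)))
      (fun t => b.semigroup t f) atTop (Set.Iic s) := by
  rw [Metric.tendstoUniformlyOn_iff]
  intro ε hε
  obtain ⟨g, hg, hgR⟩ := Metric.dense_iff.1 hR f (ε / 3) (by positivity)
  rw [Metric.mem_ball, dist_eq_norm, norm_sub_rev] at hg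
  filter_upwards [Metric.tendstoUniformlyOn_iff.1 (hT g hgR) (ε / 3) (by positivity)]
    with k hk t ht
  have h1 := hk t ht
  have h2 : ‖E k ((a k).semigroup t (P k (f - g)))‖ ≤ ‖f - g‖ := by
    rw [h.norm_map]
    exact ((a k).norm_semigroup_le t _).trans (h.norm_adjoint_le k _)
  have h3 := b.norm_semigroup_le t (f - g)
  rw [dist_eq_norm] at h1 ⊢
  have e : b.semigroup t f - E k ((a k).semigroup t (P k f)) = b.semigroup t (f - g) +
      (b.semigroup t g - E k ((a k).semigroup t (P k g))) -
      E k ((a k).semigroup t (P k (f - g))) := by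
    simp only [map_sub]; abel
  rw [e]
  have h4 := norm_sub_le (b.semigroup t (f - g) +
      (b.semigroup t g - E k ((a k).semigroup t (P k g)))) (E k ((a k).semigroup t (P k (f - g))))
  have h5 := norm_add_le (b.semigroup t (f - g))
    (b.semigroup t g - E k ((a k).semigroup t (P k g)))
  linarith

/-- The commutator estimate behind the Trotter-Kato theorem. -/
theorem norm_semigroup_resolvent_sub_sq_le (h : IsometricApproximation E P) (k : ℕ) (f : H)
    {s : ℝ≥0} {δ : ℝ} (hδ : ∀ t ≤ s, ‖E k ((a k).resolvent 1 one_pos (P k (b.semigroup t f))) -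
      b.resolvent 1 one_pos (b.semigroup t f)‖ ≤ δ) {t : ℝ≥0} (ht : t ≤ s) :
    ‖(a k).semigroup t ((a k).resolvent 1 one_pos (P k (b.resolvent 1 one_pos f))) -
      (a k).resolvent 1 one_pos (P k (b.semigroup t (b.resolvent 1 one_pos f)))‖ ^ 2 ≤
      4 * ‖f‖ * δ * t := by
  set x := b.resolvent 1 one_pos f with hx
  let Gk : H →L[ℝ] K k := ((a k).resolvent 1 one_pos).comp (P k)
  have hG1 : ∀ y, ‖Gk y‖ ≤ ‖y‖ := fun y => by
    have := (a k).norm_resolvent_le one_pos (P k y)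
    rw [one_mul] at this
    exact this.trans (h.norm_adjoint_le k y)
  have hGm : ∀ y, (Gk y, Gk y - P k y) ∈ (a k).generatorGraph := fun y => by
    have := (a k).resolvent_mem_generatorGraph one_pos (P k y)
    rwa [one_smul] at this
  have hxm : (x, x - f) ∈ b.generatorGraph := by
    have := b.resolvent_mem_generatorGraph one_pos f
    rwa [one_smul] at this
  have hxf : ‖x‖ ≤ ‖f‖ := by
    have := b.norm_resolvent_le one_pos f
    rwa [one_mul] at this
  let z : ℝ → K k := fun r =>
    (a k).semigroup r.toNNReal (Gk x) - Gk (b.semigroup r.toNNReal x)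
  let z' : ℝ → K k := fun r =>
    (a k).semigroup r.toNNReal (Gk x - P k x) - Gk (b.semigroup r.toNNReal (x - f))
  have hzc : Continuous z := ((a k).continuous_semigroup_toNNReal _).sub
    (Gk.continuous.comp (b.continuous_semigroup_toNNReal x))
  have hz : ∀ r, 0 ≤ r → HasDerivWithinAt z (z' r) (Set.Ici r) r := fun r hr =>
    (ClosedForm.hasDerivWithinAt_semigroup (hGm x) hr).sub
      (Gk.hasFDerivAt.comp_hasDerivWithinAt r (ClosedForm.hasDerivWithinAt_semigroup hxm hr))
  have hzn : ∀ r, ‖z r‖ ≤ 2 * ‖f‖ := fun r => by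
    refine (norm_sub_le _ _).trans ?_
    have h1 := ((a k).norm_semigroup_le r.toNNReal (Gk x)).trans (hG1 x)
    have h2 := (hG1 _).trans (b.norm_semigroup_le r.toNNReal x)
    linarith
  have hbound : ∀ r ∈ Set.Ico (0 : ℝ) t, 2 * ⟪z r, z' r⟫ ≤ 4 * ‖f‖ * δ := fun r hr => by
    set y := b.semigroup r.toNNReal f with hy
    -- Because `G_1` commutes with `T_r`, `z' = A^{(k)} z + q`. Dissipativity of `A^{(k)}` discards
    -- the first term in the derivative of `‖z‖²`, and `‖z‖ ≤ 2‖f‖` gives the constant `4‖f‖δ`.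
    let q := P k (E k (Gk y) - b.resolvent 1 one_pos y)
    have hq : ‖q‖ ≤ δ := (h.norm_adjoint_le k _).trans
      (hδ _ ((Real.toNNReal_le_iff_le_coe.2 hr.2.le).trans ht))
    have hm := (a k).generatorGraph.sub_mem
      (ClosedForm.semigroup_mem_generatorGraph r.toNNReal (hGm x))
      (hGm (b.semigroup r.toNNReal x))
    have h1 := ClosedForm.inner_nonpos_of_mem_generatorGraph hm
    rw [real_inner_comm] at h1
    have e : z' r = ((a k).semigroup r.toNNReal (Gk x - P k x) -
        (Gk (b.semigroup r.toNNReal x) - P k (b.semigroup r.toNNReal x))) + q := by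
      have e1 : b.resolvent 1 one_pos y = b.semigroup r.toNNReal x := b.resolvent_semigroup _ _ _
      simp only [z', q, e1, map_sub, h.leftInverse, ← hy]
      abel
    have h2 : ⟪z r, q⟫ ≤ 2 * ‖f‖ * δ := (real_inner_le_norm _ _).trans
      (mul_le_mul (hzn r) hq (norm_nonneg _) (by positivity))
    rw [e, inner_add_right]
    change ⟪z r, _⟫ ≤ 0 at h1
    linarith
  have hmain := image_le_of_deriv_right_le_deriv_boundary (a := 0) (b := t)
    (f := fun r => ‖z r‖ ^ 2) (f' := fun r => 2 * ⟪z r, z' r⟫)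
    (B := fun r => 4 * ‖f‖ * δ * r) (B' := fun _ => 4 * ‖f‖ * δ)
    (hzc.norm.pow 2).continuousOn (fun r hr => (hz r hr.1).norm_sq)
    (by simp [z, (a k).isSymmContractionSemigroup_semigroup.zero,
      b.isSymmContractionSemigroup_semigroup.zero])
    (by fun_prop) (fun r _ => by
      simpa using ((hasDerivAt_id r).const_mul (4 * ‖f‖ * δ)).hasDerivWithinAt) hbound
    ⟨t.2, le_rfl⟩
  simpa [z, Gk] using hmain

/-- It suffices to treat `G_1 x` with `x = G_1 g`. The outer resolvent lets the error split into two
resolvent errors, at `x` and at `T_t x`, and the commutator of resolvent and semigroup; the inner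
one puts `x` in the domain of `A`, as the commutator estimate requires. Compactness of the orbits of
`g` and `x` on `[0, s]` gives uniformity. -/
theorem tendstoUniformlyOn_semigroup_of_tendsto_resolvent (h : IsometricApproximation E P)
    (hG : ∀ f, Tendsto (fun k => E k ((a k).resolvent 1 one_pos (P k f))) atTop
      (𝓝 (b.resolvent 1 one_pos f))) (f : H) (s : ℝ≥0) :
    TendstoUniformlyOn (fun k t => E k ((a k).semigroup t (P k f)))
      (fun t => b.semigroup t f) atTop (Set.Iic s) := by
  let G := b.resolvent 1 one_pos
  let Gk : ∀ k, H →L[ℝ] K k := fun k => ((a k).resolvent 1 one_pos).comp (P k)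
  let B : ℕ → H →L[ℝ] H := fun k => (E k).comp (Gk k) - G
  have hdense : Dense (Set.range (G ∘ G)) :=
    (b.denseRange_resolvent one_pos).comp (b.denseRange_resolvent one_pos) G.continuous
  refine h.tendstoUniformlyOn_semigroup_of_dense hdense ?_ f
  rintro _ ⟨g, rfl⟩
  set x := G g with hx
  have hB : ∀ k y, ‖B k y‖ ≤ 2 * ‖y‖ := fun k y => by
    refine (norm_sub_le _ _).trans ?_
    have h1 := (a k).norm_resolvent_le one_pos (P k y)
    have h2 := b.norm_resolvent_le one_pos y
    have h3 := h.norm_adjoint_le k y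
    have h4 := h.norm_map k (Gk k y)
    rw [one_mul] at h1 h2
    change ‖E k (Gk k y)‖ + ‖G y‖ ≤ _
    rw [h4]
    change ‖Gk k y‖ ≤ _ at h1
    change ‖G y‖ ≤ _ at h2
    linarith
  have hB0 : ∀ y, Tendsto (fun k => B k y) atTop (𝓝 0) := fun y => by
    rw [← sub_self (G y)]
    exact (hG y).sub_const (G y)
  have hcpt : ∀ y, IsCompact ((fun t => b.semigroup t y) '' Set.Iic s) := fun y => by
    rw [← Set.Icc_bot]
    exact isCompact_Icc.image (b.isSymmContractionSemigroup_semigroup.continuous y)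
  rw [Metric.tendstoUniformlyOn_iff]
  intro ε hε
  -- Chosen so that the commutator bound `4‖g‖δt` stays below `(ε/4)²` for `t ≤ s`.
  set δ := (ε / 4) ^ 2 / (4 * (‖g‖ + 1) * (s + 1)) with hδ_def
  have hδ : 0 < δ := by positivity
  filter_upwards [eventually_forall_norm_lt_of_isCompact hB hB0 (hcpt g) hδ,
    eventually_forall_norm_lt_of_isCompact hB hB0 (hcpt x) (ε := ε / 4) (by positivity),
    (tendsto_zero_iff_norm_tendsto_zero.1 (hB0 x)).eventually_lt_const
      (show (0 : ℝ) < ε / 4 by positivity)] with k hk1 hk2 hk3 t ht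
  have h1 := h.norm_semigroup_resolvent_sub_sq_le (a := a) (b := b) k g
    (fun r hr => (hk1 _ ⟨r, hr, rfl⟩).le) ht
  set z := (a k).semigroup t (Gk k x) - Gk k (b.semigroup t x)
  change ‖z‖ ^ 2 ≤ _ at h1
  have h2 : ‖z‖ < ε / 4 := by
    refine lt_of_pow_lt_pow_left₀ 2 (by positivity) (h1.trans_lt ?_)
    have ht' : (t : ℝ) ≤ s := ht
    have e : (ε / 4) ^ 2 = 4 * (‖g‖ + 1) * δ * (s + 1) := by
      rw [hδ_def]; field_simp
    rw [e]
    have h3 : 4 * ‖g‖ * δ ≤ 4 * (‖g‖ + 1) * δ := by gcongr; linarith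
    have h4 : (0 : ℝ) < 4 * (‖g‖ + 1) * δ := by positivity
    have h5 : (0 : ℝ) ≤ t := t.2
    nlinarith [mul_le_mul_of_nonneg_right h3 h5]
  have h3 := hk2 _ ⟨t, ht, rfl⟩
  have e : E k ((a k).semigroup t (P k (G x))) - b.semigroup t (G x) =
      E k ((a k).semigroup t (P k (-(B k x)))) + E k z + B k (b.semigroup t x) := by
    have e1 : G (b.semigroup t x) = b.semigroup t (G x) := b.resolvent_semigroup _ _ _
    change _ = E k ((a k).semigroup t (P k (-(E k (Gk k x) - G x)))) + E k z +
      (E k (Gk k (b.semigroup t x)) - G (b.semigroup t x))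
    rw [e1]
    simp only [z, neg_sub, map_sub, h.leftInverse]
    abel
  have h4 : ‖E k ((a k).semigroup t (P k (-(B k x))))‖ < ε / 4 := by
    rw [h.norm_map]
    refine (((a k).norm_semigroup_le t _).trans (h.norm_adjoint_le k _)).trans_lt ?_
    rwa [norm_neg]
  rw [dist_eq_norm, norm_sub_rev]
  change ‖E k ((a k).semigroup t (P k (G x))) - b.semigroup t (G x)‖ < ε
  rw [e]
  refine (norm_add₃_le).trans_lt ?_
  rw [h.norm_map k z]
  dsimp only at h3
  linarith

end

end IsometricApproximation

/-! ### Quadratic growth and regularization for a single form. -/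

theorem eventually_sub_lt_of_ofReal_le_liminf {x : ℕ → ℝ} {c : ℝ} (hx : ∀ n, 0 ≤ x n)
    (h : ENNReal.ofReal c ≤ liminf (fun n => ENNReal.ofReal (x n)) atTop) {δ : ℝ} (hδ : 0 < δ) :
    ∀ᶠ n in atTop, c - δ < x n := by
  -- `ENNReal.ofReal` truncates at `0`, so the liminf is informative only for `c - δ ≥ 0`; otherwise
  -- nonnegativity of `x n` suffices.
  rcases lt_or_ge (c - δ) 0 with hc | hc
  · exact Eventually.of_forall fun n => hc.trans_le (hx n)
  · have h1 : ENNReal.ofReal (c - δ) < liminf (fun n => ENNReal.ofReal (x n)) atTop :=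
      lt_of_lt_of_le ((ENNReal.ofReal_lt_ofReal_iff (by linarith)).2 (by linarith)) h
    filter_upwards [eventually_lt_of_lt_liminf h1] with n hn
    exact ((ENNReal.ofReal_lt_ofReal_iff_of_nonneg hc).1 hn)

namespace ClosedForm

section

variable {H : Type*} [NormedAddCommGroup H] [InnerProductSpace ℝ H]

theorem energy_of_mem (a : ClosedForm H) {u : H} (hu : u ∈ a.domain) :
    a.energy u = ENNReal.ofReal (a.form ⟨u, hu⟩ ⟨u, hu⟩) :=
  dif_pos hu

theorem energy_of_notMem (a : ClosedForm H) {u : H} (hu : u ∉ a.domain) : a.energy u = ⊤ :=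
  dif_neg hu

theorem mem_domain_of_energy_ne_top {a : ClosedForm H} {u : H} (hu : a.energy u ≠ ⊤) :
    u ∈ a.domain := by
  by_contra h
  exact hu (a.energy_of_notMem h)

theorem form_sub_sub (a : ClosedForm H) (u v : a.domain) :
    a.form (u - v) (u - v) = a.form u u - 2 * a.form u v + a.form v v := by
  simp only [map_sub, LinearMap.sub_apply, a.symm v u]
  ring

variable [CompleteSpace H]

/-- Completing the square at the minimizer `w = G_l f`, where the functional `a(v,v) + l‖v‖² -
2⟪f,v⟫` has value `-⟪f,w⟫`: its excess at `v` equals `a(v-w,v-w) + l‖v-w‖²`. -/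
theorem mul_norm_sub_resolvent_sq_le (a : ClosedForm H) {l : ℝ} (hl : 0 < l) (f : H)
    (v : a.domain) : l * ‖(v : H) - a.resolvent l hl f‖ ^ 2 ≤
      a.form v v + l * ‖(v : H)‖ ^ 2 - 2 * ⟪f, (v : H)⟫ + ⟪f, a.resolvent l hl f⟫ := by
  set w : a.domain := ⟨a.resolvent l hl f, a.resolvent_mem hl f⟩
  have h1 := a.form_resolvent hl f v
  have h2 := a.form_resolvent hl f w
  have h3 := a.nonneg (v - w)
  change a.form w v + l * ⟪(w : H), v⟫ = _ at h1
  change a.form w w + l * ⟪(w : H), w⟫ = _ at h2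
  rw [form_sub_sub, a.symm v w] at h3
  rw [real_inner_self_eq_norm_sq] at h2
  change l * ‖(v : H) - w‖ ^ 2 ≤ _ + ⟪f, (w : H)⟫
  rw [real_inner_comm] at h1
  rw [norm_sub_sq_real]
  linarith

/-- The regularization `l G_l u` of `u`, as an element of the domain. -/
noncomputable def regularize (a : ClosedForm H) (l : ℝ) (hl : 0 < l) (u : H) : a.domain :=
  ⟨l • a.resolvent l hl u, a.domain.smul_mem l (a.resolvent_mem hl u)⟩

/-- This is what lets form values pass to the limit in `k`: against a regularized element the form
becomes an inner product. -/
theorem form_regularize (a : ClosedForm H) {l : ℝ} (hl : 0 < l) (u : H) (v : a.domain) :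
    a.form (a.regularize l hl u) v = l * ⟪u - (a.regularize l hl u : H), (v : H)⟫ := by
  have h1 := a.form_resolvent hl u v
  have e : a.regularize l hl u =
    l • (⟨a.resolvent l hl u, a.resolvent_mem hl u⟩ : a.domain) := rfl
  rw [e, map_smul, LinearMap.smul_apply, inner_sub_left, Submodule.coe_smul,
    real_inner_smul_left, smul_eq_mul, ← h1]
  ring

theorem form_regularize_self_le (a : ClosedForm H) {l : ℝ} (hl : 0 < l) (u : a.domain) :
    a.form (a.regularize l hl (u : H)) (a.regularize l hl (u : H)) ≤ a.form u u := by
  set w := a.regularize l hl (u : H) with hw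
  have h1 : a.form w (u - w) = l * ‖((u - w : a.domain) : H)‖ ^ 2 := by
    rw [hw, form_regularize, ← real_inner_self_eq_norm_sq]; rfl
  have h2 : 0 ≤ l * ‖((u - w : a.domain) : H)‖ ^ 2 := by positivity
  have h3 := a.nonneg (u - w)
  rw [form_sub_sub, a.symm u w] at h3
  rw [map_sub] at h1
  linarith

/-- With `v`, `w` the regularizations at `l`, `m`, the claim amounts to `a(v, w - v) ≥ 0`. It makes
the energies monotone in the parameter and lets their increments control the form distance, hence
the Cauchy property. -/
theorem form_regularize_sub_le (a : ClosedForm H) {l m : ℝ} (hl : 0 < l) (hm : 0 < m)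
    (hlm : l ≤ m) (u : H) :
    a.form (a.regularize m hm u - a.regularize l hl u) (a.regularize m hm u - a.regularize l hl u)
      ≤ a.form (a.regularize m hm u) (a.regularize m hm u) -
        a.form (a.regularize l hl u) (a.regularize l hl u) := by
  have h1 := a.form_regularize hl u
  have h2 := a.form_regularize hm u
  set v := a.regularize l hl u
  set w := a.regularize m hm u
  set p : H := u - v with hp
  set q : H := u - w with hq
  have e : ((w - v : a.domain) : H) = p - q := by
    rw [hp, hq, sub_sub_sub_cancel_left]; rfl
  have h3 := a.nonneg (w - v)
  have h4 : a.form (w - v) (w - v) = (l + m) * ⟪p, q⟫ - l * ‖p‖ ^ 2 - m * ‖q‖ ^ 2 := by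
    have h5 := h1 (w - v)
    have h6 := h2 (w - v)
    rw [map_sub a.form, LinearMap.sub_apply, h5, h6, e, inner_sub_right q p q, inner_sub_right p p q,
      real_inner_self_eq_norm_sq, real_inner_self_eq_norm_sq, real_inner_comm p q]
    ring
  have h5 : ⟪p, q⟫ ≤ ‖p‖ * ‖q‖ := real_inner_le_norm p q
  -- By `h3`, `h4` and Cauchy-Schwarz, `0 ≤ (‖p‖ - ‖q‖)(m‖q‖ - l‖p‖)`; if `‖p‖ < ‖q‖`, the second
  -- factor is positive and the product negative.
  have h6 : ‖q‖ ≤ ‖p‖ := by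
    by_contra! hlt
    have h7 : (l + m) * ⟪p, q⟫ ≤ (l + m) * (‖p‖ * ‖q‖) :=
      mul_le_mul_of_nonneg_left h5 (by positivity)
    have h8 : l * ‖p‖ < m * ‖q‖ := by
      calc l * ‖p‖ < l * ‖q‖ := mul_lt_mul_of_pos_left hlt hl
        _ ≤ m * ‖q‖ := mul_le_mul_of_nonneg_right hlm (norm_nonneg _)
    nlinarith [mul_pos (sub_pos.2 hlt) (sub_pos.2 h8)]
  have h7 : ⟪p, q⟫ ≤ ‖p‖ ^ 2 := by nlinarith [norm_nonneg p]
  have h8 : a.form v (w - v) = l * (‖p‖ ^ 2 - ⟪p, q⟫) := by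
    rw [h1, e, inner_sub_right, real_inner_self_eq_norm_sq]
  have h9 : 0 ≤ a.form v (w - v) := by
    rw [h8]; exact mul_nonneg hl.le (by linarith)
  rw [map_sub] at h9
  rw [form_sub_sub, a.symm w v]
  linarith

/-- Bounded monotone energies converge, so the regularizations are Cauchy for the form norm.
Closedness gives a limit in the domain, which must be `u` since `l G_l u → u`. -/
theorem energy_le_of_forall_regularize (a : ClosedForm H) (u : H) {M : ℝ≥0∞}
    (h : ∀ n : ℕ, a.energy (a.regularize ((n : ℝ) + 1) n.cast_add_one_pos u) ≤ M) :
    a.energy u ≤ M := by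
  rcases eq_or_ne M ⊤ with rfl | hM
  · exact le_top
  let x : ℕ → a.domain := fun n => a.regularize ((n : ℝ) + 1) n.cast_add_one_pos u
  have hx : ∀ n, a.form (x n) (x n) ≤ M.toReal := fun n => by
    have h1 := h n
    rw [energy_of_mem _ (Subtype.coe_prop _)] at h1
    exact (ENNReal.ofReal_le_iff_le_toReal hM).1 h1
  have hgap : ∀ m n, m ≤ n →
      a.form (x n - x m) (x n - x m) ≤ a.form (x n) (x n) - a.form (x m) (x m) :=
    fun m n hmn => a.form_regularize_sub_le _ _ (by gcongr) u
  have hlim : Tendsto (fun n => (x n : H)) atTop (𝓝 u) := a.tendsto_resolvent u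
  have hmono : Monotone fun n => a.form (x n) (x n) := fun m n hmn => by
    have h1 := hgap m n hmn
    have h2 := a.nonneg (x n - x m)
    dsimp only
    linarith
  have hconv := tendsto_atTop_ciSup hmono ⟨M.toReal, by rintro _ ⟨n, rfl⟩; exact hx n⟩
  have hflip : ∀ v w : a.domain, a.form (v - w) (v - w) = a.form (w - v) (w - v) := fun v w => by
    rw [← neg_sub w v]; simp only [map_neg, LinearMap.neg_apply, neg_neg]
  obtain ⟨v, hv⟩ := a.closed x (fun ε hε => by
    obtain ⟨N₁, hN₁⟩ := Metric.cauchySeq_iff.1 hconv.cauchySeq (ε / 2) (by positivity)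
    obtain ⟨N₂, hN₂⟩ := Metric.cauchySeq_iff.1 hlim.cauchySeq (Real.sqrt (ε / 2)) (by positivity)
    refine ⟨max N₁ N₂, fun m hm n hn => ?_⟩
    have h1 : a.form (x m - x n) (x m - x n) < ε / 2 := by
      have h2 := hN₁ m (le_of_max_le_left hm) n (le_of_max_le_left hn)
      rw [Real.dist_eq, abs_lt] at h2
      rcases le_total m n with hmn | hmn
      · rw [hflip]; linarith [hgap m n hmn]
      · linarith [hgap n m hmn]
    have h2 : ‖x m - x n‖ ^ 2 < ε / 2 := by
      have h3 := hN₂ m (le_of_max_le_right hm) n (le_of_max_le_right hn)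
      rw [dist_eq_norm] at h3
      exact (Real.lt_sqrt (norm_nonneg _)).1 h3
    linarith)
  have hform : Tendsto (fun n => a.form (x n - v) (x n - v)) atTop (𝓝 0) :=
    squeeze_zero (fun n => a.nonneg _) (fun n => by
      linarith [sq_nonneg ‖x n - v‖]) hv
  have hnorm : Tendsto (fun n => ‖x n - v‖ ^ 2) atTop (𝓝 0) :=
    squeeze_zero (fun n => sq_nonneg _) (fun n => by linarith [a.nonneg (x n - v)]) hv
  have hvu : (v : H) = u := by
    refine tendsto_nhds_unique ?_ hlim
    rw [tendsto_iff_norm_sub_tendsto_zero]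
    simpa using hnorm.sqrt
  subst hvu
  rw [energy_of_mem _ v.2, ENNReal.ofReal_le_iff_le_toReal hM]
  set M' := M.toReal
  have hM' : 0 ≤ M' := ENNReal.toReal_nonneg
  refine le_of_forall_pos_le_add fun ε hε => ?_
  have hθ : 0 < ε / (M' + 1) := by positivity
  set θ := ε / (M' + 1) with hθ_def
  have hθM : θ * M' ≤ ε := by
    rw [hθ_def, div_mul_eq_mul_div, div_le_iff₀ (by positivity)]
    nlinarith
  -- Young's inequality with weight `θ`: `a(v,v) ≤ (1 + θ) a(x_n,x_n) + (1 + θ⁻¹) a(x_n - v, x_n -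
  -- v)`, with `θ` chosen so that `θ M' ≤ ε`.
  have hbd : ∀ n, a.form v v ≤
      M' + θ * M' + (θ⁻¹ * a.form (x n - v) (x n - v) + a.form (x n - v) (x n - v)) := fun n => by
    set d := x n - v with hd
    have hv : v = x n - d := by rw [hd, sub_sub_cancel]
    have h1 := a.nonneg (θ • x n + d)
    simp only [map_add, map_smul, LinearMap.add_apply, LinearMap.smul_apply, smul_eq_mul,
      a.symm d (x n)] at h1
    have h2 : 0 ≤ θ * a.form (x n) (x n) + 2 * a.form (x n) d + θ⁻¹ * a.form d d := by
      have h3 := mul_nonneg (inv_nonneg.2 hθ.le) h1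
      have e : θ⁻¹ * (θ * (θ * a.form (x n) (x n) + a.form (x n) d) +
          (θ * a.form (x n) d + a.form d d)) =
          θ * a.form (x n) (x n) + 2 * a.form (x n) d + θ⁻¹ * a.form d d := by
        field_simp; ring
      linarith
    rw [hv, form_sub_sub]
    have h3 := mul_le_mul_of_nonneg_left (hx n) hθ.le
    linarith [hx n]
  have hlim2 := ((hform.const_mul θ⁻¹).add hform).const_add (M' + θ * M')
  have h3 := ge_of_tendsto' hlim2 hbd
  change a.form v v ≤ _
  linarith

end

end ClosedForm

/-! ### Mosco convergence and resolvent convergence. -/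

namespace MoscoConverges

section

variable {K : ℕ → Type*} {H : Type*}
    [∀ k, NormedAddCommGroup (K k)] [∀ k, InnerProductSpace ℝ (K k)]
    [NormedAddCommGroup H] [InnerProductSpace ℝ H]
    {E : ∀ k, K k →L[ℝ] H} {P : ∀ k, H →L[ℝ] K k} {a : ∀ k, ClosedForm (K k)} {b : ClosedForm H}

/-- The liminf condition speaks of full sequences. The gaps are filled with `π_k u`, which keeps the
weak limit `u`, and the liminf can only grow along a subsequence. -/
theorem energy_le_liminf_subseq (hM : MoscoConverges E a b) (h : IsometricApproximation E P)
    {ψ : ℕ → ℕ} (hψ : StrictMono ψ) (v : ∀ k, K k) (u : H)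
    (hv : ∀ g : H, Tendsto (fun n => ⟪E (ψ n) (v (ψ n)), g⟫) atTop (𝓝 ⟪u, g⟫)) :
    b.energy u ≤ Filter.liminf (fun n => (a (ψ n)).energy (v (ψ n))) atTop := by
  classical
  have hmap : atTop ⊓ 𝓟 (Set.range ψ) = map ψ atTop := by
    rw [← map_comap, ← Nat.cofinite_eq_atTop, hψ.injective.comap_cofinite_eq]
  let v' : ∀ k, K k := fun k => if k ∈ Set.range ψ then v k else P k u
  have hv' : ∀ n, v' (ψ n) = v (ψ n) := fun n => if_pos ⟨n, rfl⟩
  have hlim : ∀ g : H, Tendsto (fun k => ⟪E k (v' k), g⟫) atTop (𝓝 ⟪u, g⟫) := fun g => by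
    have h1 : Tendsto (fun k => if k ∈ Set.range ψ then ⟪E k (v k), g⟫ else ⟪E k (P k u), g⟫)
        atTop (𝓝 ⟪u, g⟫) := by
      refine Tendsto.if ?_ (((h.tendsto u).inner tendsto_const_nhds).mono_left inf_le_left)
      change Tendsto _ (atTop ⊓ 𝓟 (Set.range ψ)) _
      rw [hmap, tendsto_map'_iff]
      exact hv g
    refine h1.congr fun k => ?_
    simp only [v']
    split_ifs <;> rfl
  refine (hM.liminf v' u hlim).trans ?_
  calc Filter.liminf (fun k => (a k).energy (v' k)) atTop
      ≤ Filter.liminf (fun k => (a k).energy (v' k)) (map ψ atTop) :=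
        liminf_le_liminf_of_le hψ.tendsto_atTop
    _ = Filter.liminf (fun n => (a (ψ n)).energy (v' (ψ n))) atTop := rfl
    _ = _ := by simp only [hv']

variable [∀ k, CompleteSpace (K k)] [CompleteSpace H]

/-- A recovery sequence `w` for `u = G_l f` is asymptotically minimizing for the approximate
functionals, so quadratic growth forces it to merge with their minimizers `r`. The weak limit `us`
of `r` is needed only to bound the minimum values from below. -/
theorem exists_subseq_tendsto_resolvent (hM : MoscoConverges E a b)
    (h : IsometricApproximation E P) {l : ℝ} (hl : 0 < l) (f : H) {θ : ℕ → ℕ}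
    (hθ : StrictMono θ) : ∃ φ : ℕ → ℕ, Tendsto
      (fun n => E (θ (φ n)) ((a (θ (φ n))).resolvent l hl (P (θ (φ n)) f))) atTop
      (𝓝 (b.resolvent l hl f)) := by
  set u := b.resolvent l hl f with hu
  let r : ∀ k, K k := fun k => (a k).resolvent l hl (P k f)
  have hrD : ∀ k, r k ∈ (a k).domain := fun k => (a k).resolvent_mem hl _
  have hr : ∀ k, ‖r k‖ ≤ l⁻¹ * ‖f‖ := fun k => by
    rw [le_inv_mul_iff₀ hl]
    exact ((a k).norm_resolvent_le hl _).trans (h.norm_adjoint_le k f)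
  have hform : ∀ k, (a k).form ⟨r k, hrD k⟩ ⟨r k, hrD k⟩ + l * ‖r k‖ ^ 2 = ⟪f, E k (r k)⟫ :=
    fun k => by
      rw [real_inner_comm, h.inner_left, real_inner_comm, ← real_inner_self_eq_norm_sq]
      exact (a k).form_resolvent hl (P k f) ⟨r k, hrD k⟩
  obtain ⟨us, φ, hφ, hweak⟩ := exists_subseq_tendsto_inner (fun n => E (θ n) (r (θ n)))
    (l⁻¹ * ‖f‖) (fun n => by rw [h.norm_map]; exact hr _)
  refine ⟨φ, ?_⟩
  have hψ : StrictMono (θ ∘ φ) := hθ.comp hφ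
  set ψ := θ ∘ φ
  have hlsc := hM.energy_le_liminf_subseq h hψ r us hweak
  simp only [ClosedForm.energy_of_mem _ (hrD _)] at hlsc
  have husD : us ∈ b.domain := by
    refine ClosedForm.mem_domain_of_energy_ne_top (ne_top_of_le_ne_top
      (ENNReal.ofReal_ne_top (r := ‖f‖ * (l⁻¹ * ‖f‖))) (hlsc.trans ?_))
    refine (liminf_le_limsup).trans (limsup_le_of_le (h := Eventually.of_forall fun n => ?_))
    refine ENNReal.ofReal_le_ofReal ?_
    have h1 := hform (ψ n)
    have h2 : ⟪f, E (ψ n) (r (ψ n))⟫ ≤ ‖f‖ * (l⁻¹ * ‖f‖) :=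
      (real_inner_le_norm _ _).trans
        (mul_le_mul_of_nonneg_left (by rw [h.norm_map]; exact hr _) (norm_nonneg _))
    have h3 : 0 ≤ l * ‖r (ψ n)‖ ^ 2 := by positivity
    linarith
  rw [b.energy_of_mem husD] at hlsc
  have huD : u ∈ b.domain := b.resolvent_mem hl f
  obtain ⟨w, hw, hwlim⟩ := hM.limsup u
  rw [b.energy_of_mem huD] at hwlim
  set bu := b.form ⟨u, huD⟩ ⟨u, huD⟩ with hbu
  set bs := b.form ⟨us, husD⟩ ⟨us, husD⟩ with hbs
  have hwψ := hw.comp hψ.tendsto_atTop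
  have hmin : bu + l * ‖u‖ ^ 2 - 2 * ⟪f, u⟫ ≤ bs + l * ‖us‖ ^ 2 - 2 * ⟪f, us⟫ := by
    have h1 := b.mul_norm_sub_resolvent_sq_le hl f ⟨us, husD⟩
    have h2 := b.form_resolvent hl f ⟨u, huD⟩
    change bu + l * ⟪u, u⟫ = ⟪f, u⟫ at h2
    rw [real_inner_self_eq_norm_sq] at h2
    have h3 : 0 ≤ l * ‖us - u‖ ^ 2 := by positivity
    change l * ‖us - u‖ ^ 2 ≤ bs + l * ‖us‖ ^ 2 - 2 * ⟪f, us⟫ + ⟪f, u⟫ at h1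
    linarith
  -- `‖E r‖²` need not converge under weak convergence. Its lower bound `2⟪E r, us⟫ - ‖us‖²` does,
  -- to `‖us‖²`.
  have hRlim : Tendsto (fun n => l * ‖E (ψ n) (w (ψ n))‖ ^ 2 - 2 * ⟪f, E (ψ n) (w (ψ n))⟫ -
      l * (2 * ⟪E (ψ n) (r (ψ n)), us⟫ - ‖us‖ ^ 2) + 2 * ⟪E (ψ n) (r (ψ n)), f⟫) atTop
      (𝓝 (l * ‖u‖ ^ 2 - 2 * ⟪f, u⟫ - l * (2 * ⟪us, us⟫ - ‖us‖ ^ 2) + 2 * ⟪us, f⟫)) :=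
    ((((hwψ.norm.pow 2).const_mul l).sub ((tendsto_const_nhds.inner hwψ).const_mul 2)).sub
      ((((hweak us).const_mul 2).sub_const _).const_mul l)).add ((hweak f).const_mul 2)
  rw [real_inner_self_eq_norm_sq, real_inner_comm f us] at hRlim
  have hdist : Tendsto (fun n => ‖E (ψ n) (w (ψ n)) - E (ψ n) (r (ψ n))‖ ^ 2) atTop (𝓝 0) := by
    rw [Metric.tendsto_nhds]
    intro ε hε
    have hδ : 0 < l * ε / 3 := by positivity
    -- One third each for the limsup of the energies of `w`, the liminf of those of `r`, and the
    -- convergence of the remaining terms.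
    set δ := l * ε / 3 with hδ_def
    have hsup : ∀ᶠ k in atTop, (a k).energy (w k) < ENNReal.ofReal (bu + δ) :=
      eventually_lt_of_limsup_lt (hwlim.trans_lt
        ((ENNReal.ofReal_lt_ofReal_iff (by have := b.nonneg ⟨u, huD⟩; linarith)).2 (by linarith)))
    filter_upwards [hψ.tendsto_atTop.eventually hsup,
      eventually_sub_lt_of_ofReal_le_liminf (fun n => (a (ψ n)).nonneg _) hlsc hδ,
      hRlim.eventually_lt_const (lt_add_of_pos_right _ hδ)] with n h1 h2 h3
    have hwD : w (ψ n) ∈ (a (ψ n)).domain := ClosedForm.mem_domain_of_energy_ne_top h1.ne_top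
    rw [ClosedForm.energy_of_mem _ hwD,
      ENNReal.ofReal_lt_ofReal_iff_of_nonneg ((a (ψ n)).nonneg _)] at h1
    have h4 := (a (ψ n)).mul_norm_sub_resolvent_sq_le hl (P (ψ n) f) ⟨w (ψ n), hwD⟩
    change l * ‖w (ψ n) - r (ψ n)‖ ^ 2 ≤ _ + l * ‖w (ψ n)‖ ^ 2 - 2 * ⟪P (ψ n) f, w (ψ n)⟫ +
      ⟪P (ψ n) f, r (ψ n)⟫ at h4
    rw [real_inner_comm (w (ψ n)), ← h.inner_left, real_inner_comm (r (ψ n)), ← h.inner_left,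
      ← h.norm_map, map_sub, ← h.norm_map _ (w (ψ n))] at h4
    have h5 := hform (ψ n)
    rw [← h.norm_map] at h5
    have h6 : 2 * ⟪E (ψ n) (r (ψ n)), us⟫ - ‖us‖ ^ 2 ≤ ‖E (ψ n) (r (ψ n))‖ ^ 2 := by
      have := sq_nonneg ‖E (ψ n) (r (ψ n)) - us‖
      rw [norm_sub_sq_real] at this
      linarith
    have h7 := mul_le_mul_of_nonneg_left h6 hl.le
    rw [real_inner_comm] at h5 h3
    rw [dist_zero_right, Real.norm_of_nonneg (sq_nonneg _)]
    refine lt_of_mul_lt_mul_left ?_ hl.le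
    have e : l * ε = 3 * δ := by rw [hδ_def]; ring
    rw [e]
    linarith
  have h0 : Tendsto (fun n => E (ψ n) (w (ψ n)) - E (ψ n) (r (ψ n))) atTop (𝓝 0) := by
    rw [tendsto_zero_iff_norm_tendsto_zero]
    simpa using hdist.sqrt
  have h1 := hwψ.sub h0
  rw [sub_zero] at h1
  refine h1.congr fun n => ?_
  exact sub_sub_cancel _ _

theorem tendsto_resolvent (hM : MoscoConverges E a b) (h : IsometricApproximation E P)
    {l : ℝ} (hl : 0 < l) (f : H) :
    Tendsto (fun k => E k ((a k).resolvent l hl (P k f))) atTop (𝓝 (b.resolvent l hl f)) := by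
  refine tendsto_of_subseq_tendsto fun ns hns => ?_
  obtain ⟨θ, -, hθ⟩ := strictMono_subseq_of_tendsto_atTop hns
  obtain ⟨φ, hφ⟩ := hM.exists_subseq_tendsto_resolvent h hl f hθ
  exact ⟨θ ∘ φ, hφ⟩

/-- For the liminf, let `y` be the regularization of `π_k u`: then `a^{(k)}(v,v) ≥ 2 a^{(k)}(y,v) -
a^{(k)}(y,y)`, whose right side converges under weak convergence of `E_k v_k`. For the limsup, the
same `y` recover the regularizations of `u`, and a diagonal choice of the parameter recovers `u`. -/
theorem of_tendsto_resolvent (h : IsometricApproximation E P)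
    (hG : ∀ (l : ℝ) (hl : 0 < l) (f : H),
      Tendsto (fun k => E k ((a k).resolvent l hl (P k f))) atTop (𝓝 (b.resolvent l hl f))) :
    MoscoConverges E a b := by
  have hreg : ∀ (l : ℝ) (hl : 0 < l) (u : H), Tendsto
      (fun k => E k ((a k).regularize l hl (P k u) : K k)) atTop
      (𝓝 (b.regularize l hl u : H)) := fun l hl u => by
    refine ((hG l hl u).const_smul l).congr fun k => ?_
    rw [← map_smul]; rfl
  have hdiff : ∀ (l : ℝ) (hl : 0 < l) (u : H), Tendsto
      (fun k => E k (P k u) - E k ((a k).regularize l hl (P k u) : K k)) atTop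
      (𝓝 (u - b.regularize l hl u)) := fun l hl u => (h.tendsto u).sub (hreg l hl u)
  have hself : ∀ (l : ℝ) (hl : 0 < l) (u : H) k, (a k).form ((a k).regularize l hl (P k u))
      ((a k).regularize l hl (P k u)) =
      l * ⟪E k (P k u) - E k ((a k).regularize l hl (P k u) : K k),
        E k ((a k).regularize l hl (P k u) : K k)⟫ := fun l hl u k => by
    rw [ClosedForm.form_regularize, ← map_sub, h.inner_map]
  have hform : ∀ (l : ℝ) (hl : 0 < l) (u : H), Tendsto
      (fun k => (a k).form ((a k).regularize l hl (P k u)) ((a k).regularize l hl (P k u))) atTop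
      (𝓝 (b.form (b.regularize l hl u) (b.regularize l hl u))) := fun l hl u => by
    simp only [hself, b.form_regularize hl u]
    exact ((hdiff l hl u).inner (hreg l hl u)).const_mul l
  constructor
  · intro v u hv
    refine b.energy_le_of_forall_regularize u fun n => ?_
    have hl : (0 : ℝ) < (n : ℝ) + 1 := n.cast_add_one_pos
    set l := (n : ℝ) + 1
    rw [ClosedForm.energy_of_mem _ (Subtype.coe_prop _)]
    have hc : Tendsto (fun k => 2 * (l * ⟪E k (v k),
        E k (P k u) - E k ((a k).regularize l hl (P k u) : K k)⟫) -
        (a k).form ((a k).regularize l hl (P k u)) ((a k).regularize l hl (P k u))) atTop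
        (𝓝 (2 * (l * ⟪u, u - b.regularize l hl u⟫) -
          b.form (b.regularize l hl u) (b.regularize l hl u))) :=
      (((tendsto_inner_of_tendsto_of_weak hv (hdiff l hl u)).const_mul l).const_mul 2).sub
        (hform l hl u)
    -- Here `l * ⟪u, u - b.regularize l hl u⟫` plays the role of `a(u, w)`, `w` being the
    -- regularization, and makes sense even if `u` is not in the domain.
    have hle : b.form (b.regularize l hl u) (b.regularize l hl u) ≤
        2 * (l * ⟪u, u - b.regularize l hl u⟫) -
          b.form (b.regularize l hl u) (b.regularize l hl u) := by
      have h1 : l * ⟪u, u - b.regularize l hl u⟫ =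
          b.form (b.regularize l hl u) (b.regularize l hl u) +
            l * ‖u - b.regularize l hl u‖ ^ 2 := by
        rw [b.form_regularize hl u, ← real_inner_self_eq_norm_sq, ← mul_add, ← inner_add_right,
          add_sub_cancel, real_inner_comm]
      have h2 : 0 ≤ l * ‖u - b.regularize l hl u‖ ^ 2 := by positivity
      linarith
    refine (ENNReal.ofReal_le_ofReal hle).trans ?_
    rw [← (ENNReal.tendsto_ofReal hc).liminf_eq]
    refine liminf_le_liminf (Eventually.of_forall fun k => ?_)
    by_cases hvD : v k ∈ (a k).domain
    · rw [ClosedForm.energy_of_mem _ hvD]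
      refine ENNReal.ofReal_le_ofReal ?_
      have h1 := (a k).nonneg (⟨v k, hvD⟩ - (a k).regularize l hl (P k u))
      rw [ClosedForm.form_sub_sub, (a k).symm ⟨v k, hvD⟩ ((a k).regularize l hl (P k u))] at h1
      have h2 := (a k).form_regularize hl (P k u) ⟨v k, hvD⟩
      rw [← map_sub, h.inner_map, real_inner_comm]
      linarith
    · rw [ClosedForm.energy_of_notMem _ hvD]
      exact le_top
  · intro u
    by_cases huD : u ∈ b.domain
    · rw [b.energy_of_mem huD]
      set bu := b.form ⟨u, huD⟩ ⟨u, huD⟩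
      let x : ℕ → b.domain := fun n => b.regularize ((n : ℝ) + 1) n.cast_add_one_pos u
      let y : ℕ → ∀ k, (a k).domain := fun n k =>
        (a k).regularize ((n : ℝ) + 1) n.cast_add_one_pos (P k u)
      have hinv : ∀ n : ℕ, (0 : ℝ) < 1 / ((n : ℝ) + 1) := fun n => Nat.one_div_pos_of_nat
      have hQ : ∀ n : ℕ, ∀ᶠ k in atTop,
          ‖E k (y n k : K k) - u‖ < ‖(x n : H) - u‖ + 1 / ((n : ℝ) + 1) ∧
          (a k).form (y n k) (y n k) < bu + 1 / ((n : ℝ) + 1) := fun n => by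
        have h1 := ((hreg _ n.cast_add_one_pos u).sub_const u).norm
        have h2 := hform _ n.cast_add_one_pos u
        have h3 : b.form (x n) (x n) ≤ bu :=
          b.form_regularize_self_le n.cast_add_one_pos ⟨u, huD⟩
        exact (h1.eventually_lt_const (lt_add_of_pos_right _ (hinv n))).and
          (h2.eventually_lt_const (lt_of_le_of_lt h3 (lt_add_of_pos_right _ (hinv n))))
      obtain ⟨N, hN, hQN⟩ := exists_diagonal_of_eventually hQ
      have hinv0 := (tendsto_one_div_add_atTop_nhds_zero_nat (𝕜 := ℝ)).comp hN
      refine ⟨fun k => y (N k) k, ?_, ?_⟩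
      · rw [tendsto_iff_norm_sub_tendsto_zero]
        have h1 : Tendsto (fun n => ‖(x n : H) - u‖) atTop (𝓝 0) :=
          tendsto_iff_norm_sub_tendsto_zero.1 (b.tendsto_resolvent u)
        have h2 := (h1.comp hN).add hinv0
        rw [add_zero] at h2
        exact squeeze_zero' (Eventually.of_forall fun k => norm_nonneg _)
          (hQN.mono fun k hk => hk.1.le) h2
      · have h1 := hinv0.const_add bu
        rw [add_zero] at h1
        rw [← (ENNReal.tendsto_ofReal h1).limsup_eq]
        refine limsup_le_limsup (hQN.mono fun k hk => ?_)
        dsimp only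
        rw [ClosedForm.energy_of_mem _ (Subtype.coe_prop _)]
        exact ENNReal.ofReal_le_ofReal hk.2.le
    · rw [b.energy_of_notMem huD]
      exact ⟨fun k => P k u, h.tendsto u, le_top⟩

end

end MoscoConverges

/-! ### The equivalences, each passing through resolvent convergence. -/

theorem theorem8p2 {K : ℕ → Type*} {H : Type*}
    [∀ k, NormedAddCommGroup (K k)] [∀ k, InnerProductSpace ℝ (K k)] [∀ k, CompleteSpace (K k)]
    [NormedAddCommGroup H] [InnerProductSpace ℝ H] [CompleteSpace H]
    (a : ∀ k, ClosedForm (K k)) (b : ClosedForm H)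
    (E : ∀ k, K k →L[ℝ] H) (P : ∀ k, H →L[ℝ] K k)
    (hP : ∀ k, P k = ContinuousLinearMap.adjoint (E k))
    (hPE : ∀ k v, P k (E k v) = v)
    (hbdd : BddAbove (Set.range fun k => ‖P k‖))
    (hlim : ∀ f, Tendsto (fun k => ‖P k f‖) atTop (𝓝 ‖f‖))
    (C : Submodule ℝ H) (hC : b.generator.HasCore C) :
    List.TFAE [
      MoscoConverges E a b,
      ∀ (f : H) (s : ℝ≥0), TendstoUniformlyOn (fun k t => E k ((a k).semigroup t (P k f)))
        (fun t => b.semigroup t f) atTop (Set.Iic s),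
      ∀ f : b.generator.domain, (f : H) ∈ C → ∃ u : ∀ k, (a k).generator.domain,
        Tendsto (fun k => E k (u k)) atTop (𝓝 (f : H)) ∧
        Tendsto (fun k => E k ((a k).generator (u k))) atTop (𝓝 (b.generator f)),
      ∀ (l : ℝ) (hl : 0 < l) (f : H),
        Tendsto (fun k => E k ((a k).resolvent l hl (P k f))) atTop (𝓝 (b.resolvent l hl f))] := by
  have h := IsometricApproximation.of_adjoint hP hPE hlim
  tfae_have 1 → 4 := fun hM _ hl f => hM.tendsto_resolvent h hl f
  tfae_have 4 → 1 := MoscoConverges.of_tendsto_resolvent h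
  tfae_have 4 → 2 := fun hG f s =>
    h.tendstoUniformlyOn_semigroup_of_tendsto_resolvent (hG 1 one_pos) f s
  tfae_have 2 → 4 := fun hT _ hl f => h.tendsto_resolvent_of_tendsto_semigroup hT hl f
  tfae_have 4 → 3 := fun hG f _ => h.tendsto_generator_of_tendsto_resolvent (hG 1 one_pos) f
  tfae_have 3 → 4 := fun hA _ hl f => h.tendsto_resolvent_of_tendsto_generator hC hA hl f
  tfae_finish
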